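/- Let $G$ be a group generated by a finite set $P=P^{-1}$. Let $(Q_n)$ be a sequence of finite subsets of $G$ with the following properties: it is a F\o lner sequence, i.e. $|PQ_n\setminus Q_n|/|Q_n|\to 0$; each $Q_n$ is a monotile, i.e. $G$ is the disjoint union of the sets $Q_nt$, $t\in T_n$, for some $T_n\subseteq G$; it is tempered, i.e. for some $C>0$ we have $\left|\bigcup_{k<n}Q_k^{-1}Q_n\right|\le C|Q_n|$ for all $n$; and it is strictly increasing, i.e. $|Q_{n+1}|>|Q_n|$ for all $n$. (In particular $G$ is infinite and amenable.) Let $p\in\ell^1(G)$ satisfy $0<p(x)<1$ and $p(x)=p(x^{-1})$ for all $x\in G$. Let $\Gamma$ be the complete undirected graph on the vertex set $G$, let $\Gamma_\omega$ be the random subgraph with vertex set $G$ in which the edges $[x,y]$ of $\Gamma$ are present independently of each other, $[x,y]$ with probability $p(xy^{-1})$, and let $\mathbb P$ be the corresponding product measure. When $\Gamma_\omega$ is locally finite, write $\Delta_\omega$ for the graph Laplacian of $\Gamma_\omega$, acting on finitely supported functions $f:G\to\mathbb C$ by \[ \Delta_\omega f(x)=\sum_{y:\,[x,y]\in E(\Gamma_\omega)}\bigl(f(x)-f(y)\bigr).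 \] For finite $Q\subset G$ let $\Delta_\omega[Q]$ be the restriction of $\Delta_\omega$ to $\ell^2(Q)$ (extend by zero, apply $\Delta_\omega$, restrict to $Q$), and let $n(\Delta_\omega[Q])(E)$ be the number of eigenvalues of $\Delta_\omega[Q]$, counted with multiplicity, not exceeding $E\in\mathbb R$. Then almost surely $\Gamma_\omega$ is locally finite, and there is a non-random function $N:\mathbb R\to\mathbb R$, the integrated density of states (IDS), such that almost surely $n(\Delta_\omega[Q_n])/|Q_n|\to N$ uniformly on $\mathbb R$. The set of points of discontinuity of $N$ equals \[ W=\{\lambda\in\mathbb R \mid \lambda\in\sigma(\Delta_S)\text{ for some finite subgraph } S \text{ of } \Gamma\}, \] where for a finite subgraph $S=(V_S,E_S)$ of $\Gamma$ the operator $\Delta_S$ on $\ell^2(V_S)$ is given by $\Delta_Sf(x)=\sum_{y\in V_S:\,[x,y]\in E_S}(f(x)-f(y))$. In particular, the set of points of discontinuity of $N$ contains no transcendental number. -/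

import Mathlib

open Filter Topology MeasureTheory ProbabilityTheory
open scoped Pointwise

noncomputable section

namespace LongRangePercolation

/-! ### Følner sequences of monotiles -/

section Group

variable {G : Type*} [Group G]

open Classical in
/-- `Q` is a Følner sequence of finite subsets of `G` with respect to the finite generating
set `P`: `|P Q_j \ Q_j| / |Q_j| → 0`. -/
def IsFolnerSeq (P : Finset G) (Q : ℕ → Finset G) : Prop :=
  Tendsto (fun j => (((P * Q j) \ Q j).card : ℝ) / ((Q j).card : ℝ)) atTop (𝓝 0)

/-- A finite set `Q` is a monotile if `G` is the disjoint union of translates `Q t`, `t ∈ T`,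
for some `T ⊆ G`. -/
def IsMonotile (Q : Finset G) : Prop :=
  ∃ T : Set G, T.PairwiseDisjoint (fun t => (Q : Set G) * {t}) ∧
    (⋃ t ∈ T, (Q : Set G) * {t}) = Set.univ

open Classical in
/-- The sequence `Q` is tempered: `|⋃_{k<n} Q_k⁻¹ Q_n| ≤ C |Q_n|` for all `n`. -/
def IsTempered (Q : ℕ → Finset G) : Prop :=
  ∃ C : ℝ, 0 < C ∧ ∀ n,
    (((Finset.range n).biUnion (fun k => (Q k)⁻¹ * Q n)).card : ℝ) ≤ C * ((Q n).card : ℝ)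

/-- The sequence `Q` is strictly increasing in cardinality. -/
def IsStrictlyIncreasing (Q : ℕ → Finset G) : Prop :=
  ∀ n, (Q n).card < (Q (n + 1)).card

end Group

/-! ### The percolation model -/

section Model

/-- The edges of the complete undirected graph on `G`. -/
abbrev Edge (G : Type*) : Type _ := (⊤ : SimpleGraph G).edgeSet

/-- Configurations: each edge is open (`true`) or closed (`false`). The σ-algebra is the
product σ-algebra, generated by the cylinder sets. -/
abbrev Config (G : Type*) : Type _ := Edge G → Bool

variable {G : Type*}

/-- The random graph `Γ_ω` with vertex set `G` whose edges are the open edges of `ω`. -/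
def openGraph (ω : Config G) : SimpleGraph G where
  Adj x y := ∃ h : s(x, y) ∈ (⊤ : SimpleGraph G).edgeSet, ω ⟨s(x, y), h⟩ = true
  symm := ⟨fun x y => by rw [Sym2.eq_swap]; exact id⟩
  loopless := ⟨fun x ⟨h, _⟩ => by simp at h⟩

variable [Group G]

/-- The probability `p(x y⁻¹)` that the edge `[x, y]` is open. -/
def edgeProb (p : G → unitInterval) (hp : ∀ x, p x⁻¹ = p x) : Sym2 G → unitInterval :=
  Sym2.lift ⟨fun x y => p (x * y⁻¹), fun x y => by simpa using (hp (x * y⁻¹)).symm⟩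

/-- The product measure on configurations: edges are independent, and `[x, y]` is open with
probability `p(x y⁻¹)`, closed with probability `1 - p(x y⁻¹)`. -/
def percMeasure (p : G → unitInterval) (hp : ∀ x, p x⁻¹ = p x) : Measure (Config G) :=
  Measure.infinitePi (fun e : Edge G => bernoulliMeasure true false (edgeProb p hp e.1))

end Model

/-! ### Laplacians -/

section Laplacian

variable {G : Type*}

open Classical in
/-- The Laplacian of a (locally finite) graph on the finitely supported functions:
`(Δ f)(x) = m(x) f(x) - ∑_{y ~ x} f(y)`, where `m(x)` is the degree of `x`. -/
def laplacian (Γ : SimpleGraph G) : (G →₀ ℂ) →ₗ[ℂ] (G → ℂ) where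
  toFun f x := ((Γ.neighborSet x).ncard : ℂ) * f x - f.sum (fun y c => if Γ.Adj x y then c else 0)
  map_add' f g := by
    ext x
    rw [Finsupp.sum_add_index' (by simp) (by intros; split_ifs <;> simp)]
    simp only [Finsupp.add_apply, Pi.add_apply]
    ring
  map_smul' c f := by
    ext x
    rw [Finsupp.sum_smul_index' (by simp)]
    simp only [Finsupp.smul_apply, Pi.smul_apply, RingHom.id_apply, smul_eq_mul, mul_sub,
      Finsupp.sum, Finset.mul_sum, mul_ite, mul_zero]
    ring

/-- The inclusion `i_Q`, extension by zero of functions on the finite set `Q`. -/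
def inclusion (Q : Finset G) : (Q → ℂ) →ₗ[ℂ] (G →₀ ℂ) :=
  Finsupp.lmapDomain ℂ ℂ (fun x : Q => (x : G)) ∘ₗ
    (Finsupp.linearEquivFunOnFinite ℂ ℂ Q).symm.toLinearMap

/-- The projection `p_Q`, restriction of functions to the finite set `Q`. -/
def projection (Q : Finset G) : (G → ℂ) →ₗ[ℂ] (Q → ℂ) :=
  LinearMap.funLeft ℂ ℂ (fun x : Q => (x : G))

open Classical in
/-- The matrix of the restriction `p_Q Δ i_Q`. Since `i_Q` takes values in the finitely supported
functions, only the action of the Laplace operator on these enters. -/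
def restrictedLaplacian (Γ : SimpleGraph G) (Q : Finset G) : Matrix Q Q ℂ :=
  LinearMap.toMatrix' (projection Q ∘ₗ laplacian Γ ∘ₗ inclusion Q)

open Classical in
theorem restrictedLaplacian_apply (Γ : SimpleGraph G) (Q : Finset G) (x y : Q) :
    restrictedLaplacian Γ Q x y =
      (if x = y then ((Γ.neighborSet (x : G)).ncard : ℂ) else 0) -
        (if Γ.Adj (x : G) (y : G) then 1 else 0) := by
  have h : inclusion Q (Pi.single y (1 : ℂ)) = Finsupp.single (y : G) 1 := by
    simp [inclusion, Finsupp.linearEquivFunOnFinite_symm_single]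
  rw [restrictedLaplacian, LinearMap.toMatrix'_apply]
  simp only [LinearMap.comp_apply, h]
  by_cases hxy : x = y
  · subst hxy; simp [projection, laplacian, LinearMap.funLeft_apply]
  · have hxy' : (y : G) ≠ x := fun h => hxy (Subtype.ext h.symm)
    simp [projection, laplacian, LinearMap.funLeft_apply, hxy, Finsupp.single_apply, hxy']

theorem restrictedLaplacian_isHermitian (Γ : SimpleGraph G) (Q : Finset G) :
    (restrictedLaplacian Γ Q).IsHermitian := by
  classical
  ext x y
  rw [Matrix.conjTranspose_apply, restrictedLaplacian_apply, restrictedLaplacian_apply]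
  by_cases hxy : x = y
  · subst hxy; simp
  · simp [hxy, Ne.symm hxy, Γ.adj_comm (y : G) (x : G), apply_ite (starRingEnd ℂ)]

/-- The eigenvalue counting function of a Hermitian matrix: the number of eigenvalues, counted
with multiplicity, not exceeding `E`. -/
def eigenvalueCount {n : Type*} [Fintype n] [DecidableEq n] {A : Matrix n n ℂ}
    (hA : A.IsHermitian) (E : ℝ) : ℕ :=
  {i : n | hA.eigenvalues i ≤ E}.ncard

open Classical in
/-- The normalised eigenvalue counting function `n(Δ_ω[Q])(E) / |Q|`. -/
def normalizedCount (ω : Config G) (Q : Finset G) (E : ℝ) : ℝ :=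
  (eigenvalueCount (restrictedLaplacian_isHermitian (openGraph ω) Q) E : ℝ) / (Q.card : ℝ)

open Classical in
/-- The set `W` of all `lam ∈ ℝ` that lie in the spectrum of the Laplacian of some finite
subgraph of the complete graph on `G`. -/
def finiteSubgraphSpectra (G : Type*) : Set ℝ :=
  {lam : ℝ | ∃ (S : (⊤ : SimpleGraph G).Subgraph) (_ : Fintype S.verts),
    (lam : ℂ) ∈ spectrum ℂ (S.coe.lapMatrix ℂ)}

/-- `N` is the integrated density of states along the sequence `Q`: a (non-random) function such
that, for almost every `ω`, the graph `Γ_ω` is locally finite (so that all `Δ_ω[Q_j]` are defined)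
and the normalised eigenvalue counting functions of `Δ_ω[Q_j]` converge to `N` in supremum norm. -/
def IsIDS [Group G] (p : G → unitInterval) (hp : ∀ x, p x⁻¹ = p x) (Q : ℕ → Finset G)
    (N : ℝ → ℝ) : Prop :=
  ∀ᵐ ω ∂(percMeasure p hp), (∀ x, ((openGraph ω).neighborSet x).Finite) ∧
    TendstoUniformly (fun j => normalizedCount ω (Q j)) N atTop

end Laplacian

end LongRangePercolation

end

/-! Everything is compared with independent copies of a finite-volume model. Fix a monotile `R` and
tile `G` by translates `R t`. By the Følner property a large `Q n` is filled by whole tiles up to a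
vanishing proportion. Delete the uncovered points and the points with an open edge leaving their
tile: what remains is a common principal submatrix of the restricted Laplacian and of the direct sum
of tile Laplacians, so Cauchy interlacing bounds the difference of the counting functions by the
number of deleted points, uniformly in `E` (`abs_eigenvalueCount_sub_sum_tiles_le`). Borel–Cantelli
controls two random quantities: an exponential moment bounds the open crossing edges by about `exp 1
* boundaryWeight p R` per point, and Hoeffding's inequality makes pattern frequencies in the
independent, identically distributed tiles converge. Hence the normalised count is eventually within
`6 * boundaryWeight p R + δ` of the deterministic `approxIDS hp R`. With `R = Q m` the boundary
weight tends to zero by dominated convergence, which gives `N` as a uniform limit of the functions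
`approxIDS hp (Q m)` (`exists_isIDS`).

Each `approxIDS` is a finite combination of step functions jumping only in `W`, so `N` is continuous
off `W`. Conversely, summability of `p` makes a given finite graph appear as an isolated piece with
probability bounded below, uniformly in volume and position (`exists_le_measure_isIsolatedCopy`).
Its eigenfunctions, extended by zero, give a positive density of eigenvalues `lam`, so the jumps of
`approxIDS` at `lam` stay bounded below and survive in the limit (`exists_le_approxIDS_sub`). Points
of `W` are algebraic because graph Laplacians have integer entries. -/

noncomputable section

namespace LongRangePercolation

/-! ### Eigenvalue counting for Hermitian matrices: interlacing, direct sums, multiplicities. -/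

section LinearAlgebra

set_option linter.unusedSectionVars false

open Matrix

variable {ι κ : Type*} [Fintype ι] [DecidableEq ι] [Fintype κ] [DecidableEq κ]

theorem eigenvalueCount_eq_card {A : Matrix ι ι ℂ} (hA : A.IsHermitian) (E : ℝ) :
    eigenvalueCount hA E = Fintype.card {i : ι // hA.eigenvalues i ≤ E} := by
  rw [eigenvalueCount, ← Nat.card_coe_set_eq, Nat.card_eq_fintype_card]
  rfl

theorem eigenvalueCount_add_card_lt {A : Matrix ι ι ℂ} (hA : A.IsHermitian) (E : ℝ) :
    eigenvalueCount hA E + Fintype.card {i : ι // E < hA.eigenvalues i} = Fintype.card ι := by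
  have h := Fintype.card_subtype_compl (fun i => hA.eigenvalues i ≤ E)
  have h' := Fintype.card_subtype_le (fun i => hA.eigenvalues i ≤ E)
  simp only [not_le] at h
  rw [eigenvalueCount_eq_card, h]
  omega

theorem eigenvalueCount_le_card {A : Matrix ι ι ℂ} (hA : A.IsHermitian) (E : ℝ) :
    eigenvalueCount hA E ≤ Fintype.card ι := by
  have := eigenvalueCount_add_card_lt hA E
  omega

/-- Passing to the characteristic polynomial frees the count from the chosen diagonalisation; equal
matrices and direct sums are then handled algebraically. -/
theorem eigenvalueCount_eq_countP {A : Matrix ι ι ℂ} (hA : A.IsHermitian) (E : ℝ) :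
    eigenvalueCount hA E = A.charpoly.roots.countP (fun z => z.re ≤ E) := by
  rw [hA.roots_charpoly_eq_eigenvalues, Multiset.countP_map, eigenvalueCount_eq_card,
    Fintype.card_subtype]
  simp
  rfl

theorem star_dotProduct_self_eq_sum (v : ι → ℂ) : star v ⬝ᵥ v = ((∑ i, ‖v i‖ ^ 2 : ℝ) : ℂ) := by
  simp [dotProduct, Complex.conj_mul']

theorem eigenvectorUnitary_conjTranspose_mul_self {A : Matrix ι ι ℂ} (hA : A.IsHermitian) :
    (hA.eigenvectorUnitary : Matrix ι ι ℂ)ᴴ * (hA.eigenvectorUnitary : Matrix ι ι ℂ) = 1 :=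
  Unitary.coe_star_mul_self hA.eigenvectorUnitary

theorem eigenvectorUnitary_mul_conjTranspose_self {A : Matrix ι ι ℂ} (hA : A.IsHermitian) :
    (hA.eigenvectorUnitary : Matrix ι ι ℂ) * (hA.eigenvectorUnitary : Matrix ι ι ℂ)ᴴ = 1 :=
  Unitary.coe_mul_star_self hA.eigenvectorUnitary

theorem eq_eigenvectorUnitary_mul_diagonal {A : Matrix ι ι ℂ} (hA : A.IsHermitian) :
    A = (hA.eigenvectorUnitary : Matrix ι ι ℂ) * diagonal (fun i => (hA.eigenvalues i : ℂ)) *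
      (hA.eigenvectorUnitary : Matrix ι ι ℂ)ᴴ := by
  conv_lhs => rw [hA.spectral_theorem, Unitary.conjStarAlgAut_apply]
  rfl

/-- The coordinates of `v` in the eigenbasis of `A`. -/
def eigenCoord {A : Matrix ι ι ℂ} (hA : A.IsHermitian) (v : ι → ℂ) : ι → ℂ :=
  (hA.eigenvectorUnitary : Matrix ι ι ℂ)ᴴ *ᵥ v

theorem eigenvectorUnitary_mulVec_eigenCoord {A : Matrix ι ι ℂ} (hA : A.IsHermitian) (v : ι → ℂ) :
    (hA.eigenvectorUnitary : Matrix ι ι ℂ) *ᵥ eigenCoord hA v = v := by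
  rw [eigenCoord, mulVec_mulVec, eigenvectorUnitary_mul_conjTranspose_self, one_mulVec]

theorem eigenCoord_mulVec {A : Matrix ι ι ℂ} (hA : A.IsHermitian) (v : ι → ℂ) (i : ι) :
    eigenCoord hA (A *ᵥ v) i = hA.eigenvalues i * eigenCoord hA v i := by
  have : (hA.eigenvectorUnitary : Matrix ι ι ℂ)ᴴ * A =
      diagonal (fun i => (hA.eigenvalues i : ℂ)) * (hA.eigenvectorUnitary : Matrix ι ι ℂ)ᴴ := by
    have h := congrArg ((hA.eigenvectorUnitary : Matrix ι ι ℂ)ᴴ * ·)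
      (eq_eigenvectorUnitary_mul_diagonal hA)
    simpa only [← mul_assoc, eigenvectorUnitary_conjTranspose_mul_self, one_mul] using h
  rw [eigenCoord, mulVec_mulVec, this, ← mulVec_mulVec, mulVec_diagonal, eigenCoord]

theorem star_dotProduct_eq_eigenCoord {A : Matrix ι ι ℂ} (hA : A.IsHermitian) (v w : ι → ℂ) :
    star v ⬝ᵥ w = star (eigenCoord hA v) ⬝ᵥ eigenCoord hA w := by
  rw [eigenCoord, star_mulVec, conjTranspose_conjTranspose, ← dotProduct_mulVec,
    eigenvectorUnitary_mulVec_eigenCoord]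

theorem sum_norm_sq_eigenCoord {A : Matrix ι ι ℂ} (hA : A.IsHermitian) (v : ι → ℂ) :
    ∑ i, ‖eigenCoord hA v i‖ ^ 2 = ∑ i, ‖v i‖ ^ 2 := by
  have h := star_dotProduct_eq_eigenCoord hA v v
  rw [star_dotProduct_self_eq_sum, star_dotProduct_self_eq_sum] at h
  exact_mod_cast h.symm

theorem star_dotProduct_mulVec_eq_sum {A : Matrix ι ι ℂ} (hA : A.IsHermitian) (v : ι → ℂ) :
    star v ⬝ᵥ A *ᵥ v = ((∑ i, hA.eigenvalues i * ‖eigenCoord hA v i‖ ^ 2 : ℝ) : ℂ) := by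
  rw [star_dotProduct_eq_eigenCoord hA]
  simp only [dotProduct, eigenCoord_mulVec, Pi.star_apply, RCLike.star_def]
  push_cast
  refine Finset.sum_congr rfl fun i _ => ?_
  rw [← Complex.conj_mul']
  ring

theorem sum_norm_sq_pos {v : ι → ℂ} (hv : v ≠ 0) : 0 < ∑ i, ‖v i‖ ^ 2 := by
  obtain ⟨i, hi⟩ := Function.ne_iff.1 hv
  exact Finset.sum_pos' (fun _ _ => by positivity) ⟨i, Finset.mem_univ _, by
    have : 0 < ‖v i‖ := norm_pos_iff.2 hi
    positivity⟩

theorem quadForm_le {A : Matrix ι ι ℂ} (hA : A.IsHermitian) {E : ℝ} {v : ι → ℂ}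
    (hv : ∀ i, E < hA.eigenvalues i → eigenCoord hA v i = 0) :
    (star v ⬝ᵥ A *ᵥ v).re ≤ E * ∑ i, ‖v i‖ ^ 2 := by
  rw [star_dotProduct_mulVec_eq_sum hA, Complex.ofReal_re, ← sum_norm_sq_eigenCoord hA,
    Finset.mul_sum]
  refine Finset.sum_le_sum fun i _ => ?_
  rcases le_or_gt (hA.eigenvalues i) E with h | h
  · gcongr
  · simp [hv i h]

theorem lt_quadForm {A : Matrix ι ι ℂ} (hA : A.IsHermitian) {E : ℝ} {v : ι → ℂ} (hv0 : v ≠ 0)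
    (hv : ∀ i, hA.eigenvalues i ≤ E → eigenCoord hA v i = 0) :
    E * ∑ i, ‖v i‖ ^ 2 < (star v ⬝ᵥ A *ᵥ v).re := by
  have h0 := sum_norm_sq_pos hv0
  rw [star_dotProduct_mulVec_eq_sum hA, Complex.ofReal_re]
  rw [← sum_norm_sq_eigenCoord hA] at h0 ⊢
  rw [Finset.mul_sum]
  obtain ⟨i, -, hi⟩ := Finset.exists_ne_zero_of_sum_ne_zero h0.ne'
  refine Finset.sum_lt_sum (fun i _ => ?_) ⟨i, Finset.mem_univ _, ?_⟩
  · rcases le_or_gt (hA.eigenvalues i) E with h | h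
    · simp [hv i h]
    · gcongr
  · have hE : E < hA.eigenvalues i := by
      by_contra hcon
      exact hi (by simp [hv i (not_lt.1 hcon)])
    have : 0 < ‖eigenCoord hA v i‖ ^ 2 := lt_of_le_of_ne (by positivity) hi.symm
    gcongr

theorem exists_ne_zero_of_card_lt {α β : Type*} [Fintype α] [Fintype β]
    (f : (κ → ℂ) →ₗ[ℂ] (α → ℂ)) (g : (κ → ℂ) →ₗ[ℂ] (β → ℂ))
    (h : Fintype.card α + Fintype.card β < Fintype.card κ) :
    ∃ w, w ≠ 0 ∧ f w = 0 ∧ g w = 0 := by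
  have := LinearMap.ker_ne_bot_of_finrank_lt (f := f.prod g) (by simpa using h)
  obtain ⟨w, hw, hw0⟩ := Submodule.exists_mem_ne_zero_of_ne_bot this
  simp only [LinearMap.ker_prod, Submodule.mem_inf, LinearMap.mem_ker] at hw
  exact ⟨w, hw0, hw.1, hw.2⟩

/-- Cauchy interlacing for the compression `Vᴴ A V` of a Hermitian matrix. -/
theorem eigenvalueCount_compression {A : Matrix ι ι ℂ} {C : Matrix κ κ ℂ} (hA : A.IsHermitian)
    (hC : C.IsHermitian) (V : Matrix ι κ ℂ) (hV : Vᴴ * V = 1) (hCA : C = Vᴴ * A * V) (E : ℝ) :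
    eigenvalueCount hC E ≤ eigenvalueCount hA E ∧
      eigenvalueCount hA E + Fintype.card κ ≤ eigenvalueCount hC E + Fintype.card ι := by
  have hnorm : ∀ w : κ → ℂ, ∑ i, ‖(V *ᵥ w) i‖ ^ 2 = ∑ i, ‖w i‖ ^ 2 := fun w => by
    have h : star (V *ᵥ w) ⬝ᵥ (V *ᵥ w) = star w ⬝ᵥ w := by
      rw [star_mulVec, ← dotProduct_mulVec, mulVec_mulVec, hV, one_mulVec]
    rw [star_dotProduct_self_eq_sum, star_dotProduct_self_eq_sum] at h
    exact_mod_cast h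
  have hform : ∀ w : κ → ℂ, star (V *ᵥ w) ⬝ᵥ A *ᵥ (V *ᵥ w) = star w ⬝ᵥ C *ᵥ w := fun w => by
    rw [star_mulVec, ← dotProduct_mulVec, mulVec_mulVec, mulVec_mulVec, hCA]
  have hV0 : ∀ w : κ → ℂ, w ≠ 0 → V *ᵥ w ≠ 0 := fun w hw h0 => by
    have := sum_norm_sq_pos hw
    rw [← hnorm, h0] at this
    simp at this
  let cA (q : ι → Prop) : (κ → ℂ) →ₗ[ℂ] ({i // q i} → ℂ) :=
    LinearMap.funLeft ℂ ℂ Subtype.val ∘ₗ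
      ((hA.eigenvectorUnitary : Matrix ι ι ℂ)ᴴ * V).mulVecLin
  let cC (q : κ → Prop) : (κ → ℂ) →ₗ[ℂ] ({i // q i} → ℂ) :=
    LinearMap.funLeft ℂ ℂ Subtype.val ∘ₗ
      ((hC.eigenvectorUnitary : Matrix κ κ ℂ)ᴴ).mulVecLin
  have hcA : ∀ q w, cA q w = 0 → ∀ i, q i → eigenCoord hA (V *ᵥ w) i = 0 := fun q w h i hi => by
    have := congrFun h ⟨i, hi⟩
    simpa [cA, eigenCoord, LinearMap.funLeft_apply] using this
  have hcC : ∀ q w, cC q w = 0 → ∀ i, q i → eigenCoord hC w i = 0 := fun q w h i hi => by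
    have := congrFun h ⟨i, hi⟩
    simpa [cC, eigenCoord, LinearMap.funLeft_apply] using this
  have eA := eigenvalueCount_add_card_lt hA E
  have eC := eigenvalueCount_add_card_lt hC E
  constructor
  -- Otherwise a dimension count yields `w ≠ 0` in the span of the eigenvectors of `C` with
  -- eigenvalue at most `E`, with `V w` orthogonal to those of `A`: its form would be both at most
  -- and greater than `E` times its squared norm. The other bullet exchanges the roles.
  · by_contra! hlt
    obtain ⟨w, hw, h1, h2⟩ := exists_ne_zero_of_card_lt (cA fun i => hA.eigenvalues i ≤ E)
      (cC fun i => E < hC.eigenvalues i) (by rw [← eigenvalueCount_eq_card]; omega)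
    have l1 := lt_quadForm hA (hV0 w hw) (hcA _ _ h1)
    have l2 := quadForm_le hC (hcC _ _ h2)
    rw [hform, hnorm] at l1
    linarith
  · by_contra! hlt
    obtain ⟨w, hw, h1, h2⟩ := exists_ne_zero_of_card_lt (cA fun i => E < hA.eigenvalues i)
      (cC fun i => hC.eigenvalues i ≤ E) (by rw [← eigenvalueCount_eq_card]; omega)
    have l1 := quadForm_le hA (hcA _ _ h1)
    have l2 := lt_quadForm hC hw (hcC _ _ h2)
    rw [hform, hnorm] at l1
    linarith

theorem eigenvalueCount_submatrix {A : Matrix ι ι ℂ} (hA : A.IsHermitian) {e : κ → ι}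
    (he : Function.Injective e) (E : ℝ) :
    eigenvalueCount (hA.submatrix e) E ≤ eigenvalueCount hA E ∧
      eigenvalueCount hA E + Fintype.card κ ≤
        eigenvalueCount (hA.submatrix e) E + Fintype.card ι := by
  refine eigenvalueCount_compression hA _ ((1 : Matrix ι ι ℂ).submatrix id e) ?_ ?_ E
  · ext i j
    simp [mul_apply, one_apply, he.eq_iff, eq_comm]
  · ext i j
    simp [mul_apply, one_apply]

/-- Two Hermitian matrices with a common principal submatrix have close eigenvalue counts. -/
theorem abs_eigenvalueCount_sub_le {δ : Type*} [Fintype δ] {A : Matrix ι ι ℂ} {B : Matrix κ κ ℂ}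
    (hA : A.IsHermitian) (hB : B.IsHermitian) {e : δ → ι} {f : δ → κ}
    (he : Function.Injective e) (hf : Function.Injective f) (hAB : A.submatrix e e = B.submatrix f f)
    (hcard : Fintype.card κ ≤ Fintype.card ι) (E : ℝ) :
    |(eigenvalueCount hA E : ℝ) - eigenvalueCount hB E| ≤ Fintype.card ι - Fintype.card δ := by
  classical
  have h1 := eigenvalueCount_submatrix hA he E
  have h2 := eigenvalueCount_submatrix hB hf E
  have h3 : eigenvalueCount (hA.submatrix e) E = eigenvalueCount (hB.submatrix f) E := by
    rw [eigenvalueCount_eq_countP, eigenvalueCount_eq_countP, hAB]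
  rw [h3] at h1
  have a1 : (eigenvalueCount (hB.submatrix f) E : ℝ) ≤ eigenvalueCount hA E := mod_cast h1.1
  have a2 : (eigenvalueCount hA E : ℝ) + Fintype.card δ ≤
    eigenvalueCount (hB.submatrix f) E + Fintype.card ι := mod_cast h1.2
  have b1 : (eigenvalueCount (hB.submatrix f) E : ℝ) ≤ eigenvalueCount hB E := mod_cast h2.1
  have b2 : (eigenvalueCount hB E : ℝ) + Fintype.card δ ≤
    eigenvalueCount (hB.submatrix f) E + Fintype.card κ := mod_cast h2.2
  have c : (Fintype.card κ : ℝ) ≤ Fintype.card ι := mod_cast hcard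
  rw [abs_le]
  constructor <;> linarith

theorem charpoly_blockDiagonal (M : κ → Matrix ι ι ℂ) :
    (blockDiagonal M).charpoly = ∏ k, (M k).charpoly := by
  have : (blockDiagonal M).charmatrix = blockDiagonal fun k => (M k).charmatrix := by
    ext ⟨i, k⟩ ⟨j, l⟩
    by_cases hkl : k = l
    · subst hkl
      simp [charmatrix_apply, blockDiagonal_apply, diagonal_apply]
    · simp [blockDiagonal_apply, hkl]
  rw [charpoly, this, det_blockDiagonal]
  rfl

theorem isHermitian_blockDiagonal {M : κ → Matrix ι ι ℂ} (hM : ∀ k, (M k).IsHermitian) :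
    (blockDiagonal M).IsHermitian := by
  rw [IsHermitian, blockDiagonal_conjTranspose]
  exact congrArg _ (funext hM)

theorem eigenvalueCount_blockDiagonal {M : κ → Matrix ι ι ℂ} (hM : ∀ k, (M k).IsHermitian)
    (E : ℝ) : eigenvalueCount (isHermitian_blockDiagonal hM) E =
      ∑ k, eigenvalueCount (hM k) E := by
  simp only [eigenvalueCount_eq_countP]
  rw [charpoly_blockDiagonal, Polynomial.roots_prod _ _
    (Finset.prod_ne_zero_iff.2 fun k _ => (charpoly_monic (M k)).ne_zero),
    Multiset.countP_eq_card_filter, Multiset.filter_bind, Multiset.card_bind]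
  simp [Multiset.countP_eq_card_filter]

/-- There are finitely many eigenvalues, so off the spectrum the count is locally constant. -/
theorem continuousAt_eigenvalueCount {A : Matrix ι ι ℂ} (hA : A.IsHermitian) {lam : ℝ}
    (h : (lam : ℂ) ∉ spectrum ℂ A) : ContinuousAt (fun E => (eigenvalueCount hA E : ℝ)) lam := by
  have hne : ∀ i, hA.eigenvalues i ≠ lam := fun i hi => h (by
    rw [hA.spectrum_eq_image_range]
    exact ⟨lam, ⟨i, hi⟩, rfl⟩)
  have : ∀ᶠ E in 𝓝 lam, ∀ i, (hA.eigenvalues i ≤ E ↔ hA.eigenvalues i ≤ lam) := by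
    rw [eventually_all]
    intro i
    rcases lt_or_gt_of_ne (hne i) with hi | hi
    · filter_upwards [eventually_gt_nhds hi] with E hE
      exact ⟨fun _ => hi.le, fun _ => hE.le⟩
    · filter_upwards [eventually_lt_nhds hi] with E hE
      exact ⟨fun h => absurd h (not_le.2 hE), fun h => absurd h (not_le.2 hi)⟩
  refine continuousAt_const.congr (f := fun _ => (eigenvalueCount hA lam : ℝ)) ?_
  filter_upwards [this] with E hE
  simp only [eigenvalueCount, hE]

/-- If `A` has eigenvectors to the eigenvalue `lam` carrying at least the fraction `a` of their mass
at each of the points of `X`, then `lam` has multiplicity at least `a |X|`. -/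
theorem mul_card_le_multiplicity {A : Matrix ι ι ℂ} (hA : A.IsHermitian) {lam a : ℝ} (X : Finset ι)
    (hX : ∀ x ∈ X, ∃ v : ι → ℂ, v ≠ 0 ∧ A *ᵥ v = (lam : ℂ) • v ∧ a * ∑ i, ‖v i‖ ^ 2 ≤ ‖v x‖ ^ 2) :
    a * X.card ≤ ((Finset.univ.filter fun i => hA.eigenvalues i = lam).card : ℝ) := by
  set I := Finset.univ.filter fun i => hA.eigenvalues i = lam with hI
  set U := (hA.eigenvectorUnitary : Matrix ι ι ℂ) with hU
  -- The sum is the diagonal entry at `x` of the spectral projection for `lam`; Cauchy–Schwarz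
  -- bounds it below. The trace of that projection is the multiplicity.
  have key : ∀ x ∈ X, a ≤ ∑ i ∈ I, ‖U x i‖ ^ 2 := fun x hx => by
    obtain ⟨v, hv0, hv, hva⟩ := hX x hx
    have hy : ∀ i, i ∉ I → eigenCoord hA v i = 0 := fun i hi => by
      have h := eigenCoord_mulVec hA v i
      rw [hv, eigenCoord, mulVec_smul, Pi.smul_apply, smul_eq_mul] at h
      change (lam : ℂ) * eigenCoord hA v i = _ at h
      have hne : (hA.eigenvalues i : ℂ) ≠ lam := by simpa [hI] using hi
      rcases mul_eq_mul_right_iff.1 h with h | h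
      · exact absurd h.symm hne
      · exact h
    have hvx : v x = ∑ i ∈ I, U x i * eigenCoord hA v i := by
      conv_lhs => rw [← eigenvectorUnitary_mulVec_eigenCoord hA v]
      rw [mulVec, dotProduct]
      exact (Finset.sum_subset (Finset.subset_univ I) fun i _ hi => by simp [hy i hi]).symm
    have hpos := sum_norm_sq_pos hv0
    have hcs : ‖v x‖ ^ 2 ≤ (∑ i ∈ I, ‖U x i‖ ^ 2) * ∑ i, ‖v i‖ ^ 2 := by
      calc ‖v x‖ ^ 2 ≤ (∑ i ∈ I, ‖U x i‖ * ‖eigenCoord hA v i‖) ^ 2 := by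
            gcongr
            rw [hvx]
            exact (norm_sum_le _ _).trans_eq (by simp)
        _ ≤ (∑ i ∈ I, ‖U x i‖ ^ 2) * ∑ i ∈ I, ‖eigenCoord hA v i‖ ^ 2 :=
            Finset.sum_mul_sq_le_sq_mul_sq _ _ _
        _ ≤ _ := by
            rw [← sum_norm_sq_eigenCoord hA v]
            gcongr
            exact Finset.subset_univ I
    exact le_of_mul_le_mul_right (hva.trans hcs) hpos
  have hcol : ∀ i, ∑ x, ‖U x i‖ ^ 2 = 1 := fun i => by
    have h := congrFun (congrFun (eigenvectorUnitary_conjTranspose_mul_self hA) i) i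
    simp only [mul_apply, conjTranspose_apply, one_apply_eq, RCLike.star_def,
      Complex.conj_mul'] at h
    exact_mod_cast h
  calc a * X.card = ∑ x ∈ X, a := by simp [mul_comm]
    _ ≤ ∑ x ∈ X, ∑ i ∈ I, ‖U x i‖ ^ 2 := Finset.sum_le_sum key
    _ ≤ ∑ x, ∑ i ∈ I, ‖U x i‖ ^ 2 :=
        Finset.sum_le_sum_of_subset_of_nonneg (Finset.subset_univ X) fun _ _ _ =>
          Finset.sum_nonneg fun _ _ => by positivity
    _ = ∑ i ∈ I, ∑ x, ‖U x i‖ ^ 2 := Finset.sum_comm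
    _ = I.card := by simp [hcol]

theorem multiplicity_le_eigenvalueCount_sub {A : Matrix ι ι ℂ} (hA : A.IsHermitian) {E lam : ℝ}
    (h : E < lam) : ((Finset.univ.filter fun i => hA.eigenvalues i = lam).card : ℝ) ≤
      eigenvalueCount hA lam - eigenvalueCount hA E := by
  have hle : (Finset.univ.filter fun i => hA.eigenvalues i = lam).card + eigenvalueCount hA E ≤
      eigenvalueCount hA lam := by
    rw [eigenvalueCount_eq_card, eigenvalueCount_eq_card, Fintype.card_subtype,
      Fintype.card_subtype, ← Finset.card_union_of_disjoint]
    · refine Finset.card_le_card fun i hi => ?_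
      simp only [Finset.mem_union, Finset.mem_filter, Finset.mem_univ, true_and] at hi ⊢
      rcases hi with hi | hi <;> linarith
    · rw [Finset.disjoint_filter]
      intro i _ h1 h2
      linarith
  have : ((Finset.univ.filter fun i => hA.eigenvalues i = lam).card : ℝ) + eigenvalueCount hA E ≤
      eigenvalueCount hA lam := mod_cast hle
  linarith

/-- A real eigenvalue of a matrix with rational entries is algebraic. -/
theorem isAlgebraic_of_mem_spectrum_map (M : Matrix ι ι ℚ) {lam : ℝ}
    (h : (lam : ℂ) ∈ spectrum ℂ (M.map (algebraMap ℚ ℂ))) : IsAlgebraic ℚ lam := by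
  have h1 := (Matrix.mem_spectrum_iff_isRoot_charpoly).1 h
  rw [charpoly_map] at h1
  have h2 : IsAlgebraic ℚ (lam : ℂ) :=
    ⟨M.charpoly, (charpoly_monic M).ne_zero, by
      rwa [Polynomial.aeval_def, ← Polynomial.eval_map]⟩
  exact (isAlgebraic_algebraMap_iff (A := ℂ) (algebraMap ℝ ℂ).injective).1 h2

end LinearAlgebra

/-! ### Independent bonds: large deviations and pattern frequencies. -/

section BondMeasure

/-- The product of Bernoulli measures with parameters `q e`. -/
def bondMeasure {α : Type*} (q : α → unitInterval) : Measure (α → Bool) :=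
  Measure.infinitePi fun e => bernoulliMeasure true false (q e)

variable {α : Type*} (q : α → unitInterval)

instance : IsProbabilityMeasure (bondMeasure q) := by
  unfold bondMeasure
  infer_instance

theorem bernoulliMeasure_bool_singleton (r : unitInterval) (b : Bool) :
    bernoulliMeasure true false r {b} = ENNReal.ofReal (if b then (r : ℝ) else 1 - r) := by
  classical
  rw [bernoulliMeasure_apply r (MeasurableSet.singleton b)]
  have h : ∀ s : unitInterval, (unitInterval.toNNReal s : ENNReal) = ENNReal.ofReal s := fun s => by
    rw [ENNReal.ofReal, ENNReal.coe_inj]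
    exact NNReal.eq (by simp [s.2.1])
  cases b <;> simp [h]

theorem bondMeasure_cylinder (F : Finset α) (f : α → Bool) :
    bondMeasure q {ω | ∀ e ∈ F, ω e = f e} =
      ENNReal.ofReal (∏ e ∈ F, if f e then (q e : ℝ) else 1 - q e) := by
  have h : {ω : α → Bool | ∀ e ∈ F, ω e = f e} = (F : Set α).pi fun e => {f e} := by
    ext ω
    simp [Set.mem_pi]
  rw [h, bondMeasure, Measure.infinitePi_pi _ fun _ _ => MeasurableSet.singleton _,
    ENNReal.ofReal_prod_of_nonneg]
  · exact Finset.prod_congr rfl fun e _ => bernoulliMeasure_bool_singleton _ _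
  · intro e _
    have := (q e).2.1
    have := (q e).2.2
    split_ifs <;> linarith

theorem bondMeasure_open (e : α) : bondMeasure q {ω | ω e = true} = ENNReal.ofReal (q e) := by
  simpa using bondMeasure_cylinder q {e} fun _ => true

/-- The law of a subfamily of the coordinates. -/
theorem bondMeasure_map_comp {β : Type*} {f : β → α} (hf : Function.Injective f) :
    (bondMeasure q).map (fun ω b => ω (f b)) = bondMeasure fun b => q (f b) :=
  Measure.map_infinitePi_infinitePi_of_inj hf

/-- The expected number of families of `k` open edges in a set of total weight `M` is at most
`exp (exp 1 * M - k)`, hence so is the probability that there is such a family. -/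
theorem bondMeasure_exists_card_le [Countable α] (S : Set α) {M : ℝ}
    (hM : ∀ U : Finset α, (U : Set α) ⊆ S → ∑ e ∈ U, (q e : ℝ) ≤ M) (k : ℕ) :
    bondMeasure q {ω | ∃ F : Finset α, (F : Set α) ⊆ S ∧ F.card = k ∧ ∀ e ∈ F, ω e = true} ≤
      ENNReal.ofReal (Real.exp (Real.exp 1 * M - k)) := by
  classical
  have hq : ∀ e, 0 ≤ (q e : ℝ) := fun e => (q e).2.1
  have hset : {ω : α → Bool | ∃ F : Finset α, (F : Set α) ⊆ S ∧ F.card = k ∧ ∀ e ∈ F, ω e = true} =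
      ⋃ F : {F : Finset α // (F : Set α) ⊆ S ∧ F.card = k}, {ω | ∀ e ∈ F.1, ω e = true} := by
    ext ω
    simp [and_assoc]
  rw [hset]
  refine (measure_iUnion_le _).trans ?_
  rw [ENNReal.tsum_eq_iSup_sum]
  refine iSup_le fun 𝒰 => ?_
  simp only [bondMeasure_cylinder q _ fun _ => true, if_true]
  rw [← ENNReal.ofReal_sum_of_nonneg fun _ _ => Finset.prod_nonneg fun e _ => hq e]
  refine ENNReal.ofReal_le_ofReal ?_
  set U : Finset α := 𝒰.biUnion fun F => F.1 with hU
  have hUS : (U : Set α) ⊆ S := by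
    intro e he
    simp only [hU, Finset.coe_biUnion, Set.mem_iUnion] at he
    obtain ⟨F, -, he⟩ := he
    exact F.2.1 he
  have hexp : Real.exp (Real.exp 1 * M - k) = Real.exp (Real.exp 1 * M) / Real.exp 1 ^ k := by
    rw [Real.exp_sub, ← Real.exp_nat_mul, mul_one]
  rw [hexp, le_div_iff₀ (by positivity)]
  -- The power of `exp 1` is spread as one factor per edge; enlarging the sum to all subsets of `U`
  -- turns it into a product.
  calc (∑ F ∈ 𝒰, ∏ e ∈ F.1, (q e : ℝ)) * Real.exp 1 ^ k
      = ∑ F ∈ 𝒰.map (Function.Embedding.subtype _), ∏ e ∈ F, (Real.exp 1 * q e) := by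
        rw [Finset.sum_map, Finset.sum_mul]
        refine Finset.sum_congr rfl fun F _ => ?_
        rw [Function.Embedding.subtype_apply, Finset.prod_mul_distrib, Finset.prod_const, F.2.2,
          mul_comm]
    _ ≤ ∑ F ∈ U.powerset, ∏ e ∈ F, (Real.exp 1 * q e) := by
        refine Finset.sum_le_sum_of_subset_of_nonneg (fun F hF => ?_) fun F _ _ =>
          Finset.prod_nonneg fun e _ => mul_nonneg (Real.exp_pos 1).le (hq e)
        obtain ⟨F', hF', rfl⟩ := Finset.mem_map.1 hF
        exact Finset.mem_powerset.2 (Finset.subset_biUnion_of_mem (fun F => F.1) hF')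
    _ = ∏ e ∈ U, (1 + Real.exp 1 * q e) := (Finset.prod_one_add U).symm
    _ ≤ ∏ e ∈ U, Real.exp (Real.exp 1 * q e) := by
        refine Finset.prod_le_prod (fun e _ => ?_) fun e _ => ?_
        · have := mul_nonneg (Real.exp_pos 1).le (hq e)
          linarith
        · linarith [Real.add_one_le_exp (Real.exp 1 * q e)]
    _ = Real.exp (Real.exp 1 * ∑ e ∈ U, (q e : ℝ)) := by rw [← Real.exp_sum, Finset.mul_sum]
    _ ≤ Real.exp (Real.exp 1 * M) := by
        gcongr
        exact hM U hUS

/-- The joint law is a product measure, and currying it gives the product of the laws of the rows.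
-/
theorem iIndepFun_curry {Ω ι : Type*} {κ : ι → Type*} {mΩ : MeasurableSpace Ω} {P : Measure Ω}
    {𝓧 : (i : ι) → κ i → Type*} {m𝓧 : ∀ i j, MeasurableSpace (𝓧 i j)}
    {X : (i : ι) → (j : κ i) → Ω → 𝓧 i j} (mX : ∀ i j, Measurable (X i j))
    (h : iIndepFun (fun (p : (i : ι) × κ i) ω => X p.1 p.2 ω) P) :
    iIndepFun (fun i ω => (X i · ω)) P := by
  have := h.isProbabilityMeasure
  have : ∀ i j, IsProbabilityMeasure (P.map (X i j)) :=
    fun i j => Measure.isProbabilityMeasure_map (mX i j).aemeasurable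
  have hrow : ∀ i, P.map (fun ω => (X i · ω)) = Measure.infinitePi fun j => P.map (X i j) :=
    fun i => (iIndepFun_iff_map_fun_eq_infinitePi_map (mX i)).1
      (h.precomp (g := fun j : κ i => (⟨i, j⟩ : (i : ι) × κ i)) sigma_mk_injective)
  rw [iIndepFun_iff_map_fun_eq_infinitePi_map (by fun_prop)]
  simp only [hrow]
  rw [← Measure.infinitePi_map_piCurry (fun i j => P.map (X i j)),
    ← (iIndepFun_iff_map_fun_eq_infinitePi_map (fun p : (i : ι) × κ i => mX p.1 p.2)).1 h,
    Measure.map_map (by fun_prop) (measurable_pi_lambda _ fun p => mX p.1 p.2)]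
  rfl

/-- Joint injectivity says that different `t` read disjoint sets of coordinates. -/
theorem iIndepFun_restrict {τ β : Type*} {f : τ → β → α}
    (hf : Function.Injective fun p : τ × β => f p.1 p.2) :
    iIndepFun (fun t (ω : α → Bool) b => ω (f t b)) (bondMeasure q) := by
  refine iIndepFun_curry (X := fun t b (ω : α → Bool) => ω (f t b)) (by fun_prop) ?_
  have h := iIndepFun_infinitePi (P := fun e => bernoulliMeasure true false (q e))
    (X := fun _ b => b) fun _ => measurable_id
  exact h.precomp (g := fun p : (_ : τ) × β => f p.1 p.2)
    (hf.comp (Equiv.sigmaEquivProd τ β).injective)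

/-- Concentration for the number of occurrences of a pattern among independent copies. -/
theorem bondMeasure_pattern_count {τ β : Type*} [Finite β] {f : τ → β → α} (r : β → unitInterval)
    (hf : Function.Injective fun p : τ × β => f p.1 p.2) (hr : ∀ t b, q (f t b) = r b)
    (η : β → Bool) (T : Finset τ) {n : ℝ} (hT : (T.card : ℝ) ≤ n) {ε : ℝ} (hε : 0 < ε) :
    (bondMeasure q).real {ω | ε * n ≤ |∑ t ∈ T, (({η} : Set (β → Bool)).indicator 1 (fun b => ω (f t b)) -
      (bondMeasure r).real {η})|} ≤ 2 * Real.exp (-2 * ε ^ 2 * n) := by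
  have hn : 0 ≤ n := le_trans (by positivity) hT
  set c := (bondMeasure r).real {η} with hc
  let g : (β → Bool) → ℝ := ({η} : Set (β → Bool)).indicator 1
  have hg : Measurable g := measurable_of_finite g
  set Y : τ → (α → Bool) → ℝ := fun t ω => g fun b => ω (f t b) with hY
  have hmeas : ∀ t, Measurable fun (ω : α → Bool) b => ω (f t b) := fun t => by fun_prop
  have hYm : ∀ t, Measurable (Y t) := fun t => hg.comp (hmeas t)
  have hYi : ∀ t, ∫ ω, Y t ω ∂(bondMeasure q) = c := fun t => by
    have hft : Function.Injective (f t) := fun a b h =>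
      congrArg Prod.snd (hf (a₁ := (t, a)) (a₂ := (t, b)) h)
    have h1 := bondMeasure_map_comp q hft
    simp only [hr t] at h1
    rw [hc, ← h1, map_measureReal_apply (hmeas t) (Set.toFinite _).measurableSet,
      ← integral_indicator_one (hmeas t (Set.toFinite _).measurableSet)]
    rfl
  have hind : iIndepFun Y (bondMeasure q) := (iIndepFun_restrict q hf).comp (fun _ => g) fun _ => hg
  -- Hoeffding's lemma for a variable with values in `[0, 1]`: the variance proxy is `1 / 4`.
  have hsub : ∀ t, HasSubgaussianMGF (fun ω => Y t ω - c) (1 / 4) (bondMeasure q) := fun t => by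
    have h := hasSubgaussianMGF_of_mem_Icc (μ := bondMeasure q) (a := 0) (b := 1)
      (hYm t).aemeasurable (ae_of_all _ fun ω => by
        by_cases h : (fun b => ω (f t b)) = η <;> simp [hY, g, h])
    rw [hYi t] at h
    convert h using 1
    norm_num
  have hind1 : iIndepFun (fun t ω => Y t ω - c) (bondMeasure q) :=
    hind.comp (fun _ x => x - c) fun _ => by fun_prop
  have hind2 : iIndepFun (fun t ω => -(Y t ω - c)) (bondMeasure q) :=
    hind.comp (fun _ x => -(x - c)) fun _ => by fun_prop
  have hεn : 0 ≤ ε * n := by positivity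
  have h1 := HasSubgaussianMGF.measure_sum_ge_le_of_iIndepFun hind1 (s := T)
    (c := fun _ => 1 / 4) (fun t _ => hsub t) hεn
  have h2 := HasSubgaussianMGF.measure_sum_ge_le_of_iIndepFun hind2 (s := T)
    (c := fun _ => 1 / 4) (fun t _ => (hsub t).neg) hεn
  -- For empty `T` the Hoeffding exponent divides by zero, so this case is separate.
  rcases T.eq_empty_or_nonempty with rfl | hTne
  · rcases hn.eq_or_lt with rfl | hn0
    · simp
    · have : ¬ ε * n ≤ 0 := not_le.2 (by positivity)
      simp only [Finset.sum_empty, abs_zero, this, Set.ofPred_false, measureReal_empty]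
      positivity
  · have hTpos : (0 : ℝ) < T.card := by exact_mod_cast hTne.card_pos
    have hexp : Real.exp (-(ε * n) ^ 2 / (2 * ((∑ _i ∈ T, (1 / 4 : NNReal) : NNReal) : ℝ))) ≤
        Real.exp (-2 * ε ^ 2 * n) := by
      refine Real.exp_le_exp.2 ?_
      rw [Finset.sum_const, nsmul_eq_mul]
      push_cast
      rw [div_le_iff₀ (by positivity)]
      nlinarith [mul_le_mul_of_nonneg_left hT (mul_nonneg hn (sq_nonneg ε))]
    calc (bondMeasure q).real {ω | ε * n ≤ |∑ t ∈ T, (Y t ω - c)|}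
        ≤ (bondMeasure q).real ({ω | ε * n ≤ ∑ t ∈ T, (Y t ω - c)} ∪
            {ω | ε * n ≤ ∑ t ∈ T, -(Y t ω - c)}) := by
          refine measureReal_mono fun ω hω => ?_
          rw [Set.mem_ofPred_eq, le_abs] at hω
          rwa [Set.mem_union, Set.mem_ofPred_eq, Set.mem_ofPred_eq, Finset.sum_neg_distrib]
      _ ≤ _ := measureReal_union_le _ _
      _ ≤ 2 * Real.exp (-2 * ε ^ 2 * n) := by linarith

end BondMeasure

/-! ### Tiles, edge probabilities and local finiteness. -/

section Percolation

theorem countable_of_summable {α : Type*} {f : α → ℝ} (hf : ∀ x, 0 < f x) (hs : Summable f) :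
    Countable α := by
  have h := hs.countable_support
  rw [Function.support_eq_univ fun x => (hf x).ne'] at h
  exact Set.countable_univ_iff.1 h

theorem openGraph_adj_iff {V : Type*} {ω : Config V} {x y : V} (h : x ≠ y) :
    (openGraph ω).Adj x y ↔ ω ⟨s(x, y), by simpa using h⟩ = true :=
  ⟨fun ⟨_, hω⟩ => hω, fun hω => ⟨_, hω⟩⟩

variable {G : Type*} [Group G]

/-- The edge of `G` obtained by translating an edge of `R` by `t`. -/
def tileEdge (R : Finset G) (t : G) (e : Edge R) : Edge G :=
  ⟨e.1.map fun x : R => (x : G) * t, by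
    obtain ⟨e, he⟩ := e
    induction e using Sym2.ind with
    | _ x y => simpa using he⟩

/-- The configuration seen in the tile `R t`, transported to `R`. -/
def tileConfig (R : Finset G) (t : G) (ω : Config G) : Config R :=
  fun e => ω (tileEdge R t e)

theorem openGraph_tileConfig_adj {R : Finset G} {t : G} {ω : Config G} {x y : R} :
    (openGraph (tileConfig R t ω)).Adj x y ↔ (openGraph ω).Adj (x * t) (y * t) := by
  by_cases h : x = y
  · simp [h]
  · have h' : (x : G) * t ≠ y * t := fun hxy => h (Subtype.ext (mul_right_cancel hxy))
    rw [openGraph_adj_iff h, openGraph_adj_iff h']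
    rfl

/-- The translates `R t`, `t ∈ T`, are pairwise disjoint. -/
def IsPacking (R : Finset G) (T : Set G) : Prop :=
  ∀ x ∈ R, ∀ y ∈ R, ∀ s ∈ T, ∀ t ∈ T, x * s = y * t → s = t

/-- An endpoint determines its tile by the packing property. Thus different tiles use disjoint sets
of edges and their configurations are independent. -/
theorem tileEdge_injective {R : Finset G} {T : Set G} (hT : IsPacking R T) :
    Function.Injective fun p : T × Edge R => tileEdge R p.1 p.2 := by
  rintro ⟨⟨s, hs⟩, ⟨e, he⟩⟩ ⟨⟨t, ht⟩, ⟨e', he'⟩⟩ h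
  simp only [tileEdge, Subtype.mk.injEq] at h
  have hst : s = t := by
    induction e using Sym2.ind with
    | _ x y =>
      have hx : (x : G) * s ∈ e'.map fun x : R => (x : G) * t := by
        rw [← h, Sym2.map_mk]
        simp
      obtain ⟨x', -, hx'⟩ := Sym2.mem_map.1 hx
      exact hT x x.2 x' x'.2 s hs t ht hx'.symm
  subst hst
  have hinj : Function.Injective fun x : R => (x : G) * s := fun x y hxy =>
    Subtype.ext (mul_right_cancel hxy)
  have hee := Sym2.map.injective hinj h
  subst hee
  rfl

variable (p : G → unitInterval) (hp : ∀ x, p x⁻¹ = p x)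

theorem percMeasure_eq : percMeasure p hp = bondMeasure fun e : Edge G => edgeProb p hp e.1 := rfl

instance : IsProbabilityMeasure (percMeasure p hp) := by
  rw [percMeasure_eq]
  infer_instance

theorem edgeProb_mk (x y : G) : edgeProb p hp s(x, y) = p (x * y⁻¹) := rfl

theorem edgeProb_mul_left (x g : G) : edgeProb p hp s(x, g * x) = p g := by
  rw [edgeProb_mk, mul_inv_rev, mul_inv_cancel_left, hp]

/-- The edge probabilities inside `R`. -/
def tileProb (R : Finset G) (e : Edge R) : unitInterval := edgeProb p hp (e.1.map Subtype.val)

/-- The quotient `x * y⁻¹` is invariant under right translation, so all tiles have the same law. -/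
theorem edgeProb_tileEdge (R : Finset G) (t : G) (e : Edge R) :
    edgeProb p hp (tileEdge R t e).1 = tileProb p hp R e := by
  obtain ⟨e, he⟩ := e
  induction e using Sym2.ind with
  | _ x y => simp [tileEdge, tileProb, edgeProb_mk]

variable {p}

theorem ae_locallyFinite [Countable G] (hs : Summable fun x => (p x : ℝ)) :
    ∀ᵐ ω ∂(percMeasure p hp), ∀ x, ((openGraph ω).neighborSet x).Finite := by
  rw [ae_all_iff]
  intro x
  -- First Borel–Cantelli lemma: the expected degree at `x` is at most the sum of `p`.
  refine ae_finite_setOfPred_mem (s := fun y => {ω | (openGraph ω).Adj x y}) ?_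
  have hle : ∀ y, percMeasure p hp {ω | (openGraph ω).Adj x y} ≤ ENNReal.ofReal (p (x * y⁻¹)) := by
    intro y
    by_cases h : x = y
    · simp [h]
    · simp only [openGraph_adj_iff h]
      exact (bondMeasure_open _ _).le
  refine ne_top_of_le_ne_top ?_ (ENNReal.tsum_le_tsum hle)
  have hs' : Summable fun y => (p (x * y⁻¹) : ℝ) :=
    ((Equiv.inv G).trans (Equiv.mulLeft x)).summable_iff.2 hs
  rw [← ENNReal.ofReal_tsum_of_nonneg (fun y => (p _).2.1) hs']
  exact ENNReal.ofReal_ne_top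

/-- Each edge is encoded by an endpoint index and a displacement `g`. The code determines the edge,
and its probability is `p g`. -/
theorem sum_edgeProb_le (hs : Summable fun x => (p x : ℝ)) {ι : Type*} {X : Finset ι}
    {z : ι → G} {W : ι → Set G} (U : Finset (Edge G)) (hU : ∀ e ∈ U, ∃ x ∈ X, ∃ g ∈ W x, e.1 = s(z x, g * z x)) :
    ∑ e ∈ U, (edgeProb p hp e.1 : ℝ) ≤ ∑ x ∈ X, ∑' g, (W x).indicator (fun g => (p g : ℝ)) g := by
  classical
  have hnn : ∀ x g, 0 ≤ (W x).indicator (fun g => (p g : ℝ)) g := fun x g =>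
    Set.indicator_nonneg (fun g _ => (p g).2.1) g
  rcases U.eq_empty_or_nonempty with rfl | ⟨e₀, he₀⟩
  · exact Finset.sum_nonneg fun x _ => tsum_nonneg (hnn x)
  have : Nonempty ι := ⟨(hU e₀ he₀).choose⟩
  choose! fx hfx fg hfg hfe using hU
  have hinj : Set.InjOn (fun e => (fx e, fg e)) (U : Set (Edge G)) := fun e he e' he' h => by
    simp only [Prod.mk.injEq] at h
    exact Subtype.ext (by rw [hfe e he, hfe e' he', h.1, h.2])
  calc ∑ e ∈ U, (edgeProb p hp e.1 : ℝ)
      = ∑ e ∈ U, (W (fx e)).indicator (fun g => (p g : ℝ)) (fg e) := by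
        refine Finset.sum_congr rfl fun e he => ?_
        rw [Set.indicator_of_mem (hfg e he), hfe e he, edgeProb_mul_left]
    _ = ∑ q ∈ U.image fun e => (fx e, fg e), (W q.1).indicator (fun g => (p g : ℝ)) q.2 :=
        (Finset.sum_image (f := fun q : ι × G => (W q.1).indicator (fun g => (p g : ℝ)) q.2)
          hinj).symm
    _ ≤ ∑ q ∈ X ×ˢ U.image fg, (W q.1).indicator (fun g => (p g : ℝ)) q.2 := by
        refine Finset.sum_le_sum_of_subset_of_nonneg (fun q hq => ?_) fun q _ _ => hnn _ _
        obtain ⟨e, he, rfl⟩ := Finset.mem_image.1 hq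
        exact Finset.mem_product.2 ⟨hfx e he, Finset.mem_image_of_mem _ he⟩
    _ = ∑ x ∈ X, ∑ g ∈ U.image fg, (W x).indicator (fun g => (p g : ℝ)) g :=
        Finset.sum_product _ _ _
    _ ≤ _ := Finset.sum_le_sum fun x _ => (hs.indicator (W x)).sum_le_tsum _ fun g _ => hnn x g

end Percolation

/-! ### Følner geometry, tilings and boundary weight. -/

section Geometry

variable {G : Type*} [Group G]

open Classical in
/-- The proportion of points of `Q` that `g` moves out of `Q`. -/
def exitRatio (Q : Finset G) (g : G) : ℝ :=
  ((Q.filter fun x => g * x ∉ Q).card : ℝ) / Q.card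

theorem exitRatio_nonneg (Q : Finset G) (g : G) : 0 ≤ exitRatio Q g := by
  unfold exitRatio
  positivity

theorem exitRatio_le_one (Q : Finset G) (g : G) : exitRatio Q g ≤ 1 := by
  classical
  exact div_le_one_of_le₀ (by exact_mod_cast Finset.card_filter_le _ _) (by positivity)

/-- If `g * h * x` leaves `Q`, then either `h * x` already does, or `h * x` is a point of `Q` moved
out by `g`. This spreads the Følner property from generators to all of `G`. -/
theorem exitRatio_mul_le (Q : Finset G) (g h : G) :
    exitRatio Q (g * h) ≤ exitRatio Q g + exitRatio Q h := by
  classical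
  unfold exitRatio
  rw [← add_div]
  gcongr
  have hsub : (Q.filter fun x => g * h * x ∉ Q) ⊆ (Q.filter fun x => h * x ∉ Q) ∪
      (Q.filter fun x => g * x ∉ Q).image fun x => h⁻¹ * x := by
    intro x hx
    rw [Finset.mem_filter] at hx
    by_cases hhx : h * x ∈ Q
    · refine Finset.mem_union_right _ (Finset.mem_image.2 ⟨h * x, ?_, by simp⟩)
      rw [Finset.mem_filter, ← mul_assoc]
      exact ⟨hhx, hx.2⟩
    · exact Finset.mem_union_left _ (Finset.mem_filter.2 ⟨hx.1, hhx⟩)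
  have := (Finset.card_le_card hsub).trans (Finset.card_union_le _ _)
  have h2 := Finset.card_image_le (s := Q.filter fun x => g * x ∉ Q) (f := fun x => h⁻¹ * x)
  exact_mod_cast (by omega : (Q.filter fun x => g * h * x ∉ Q).card ≤
    (Q.filter fun x => g * x ∉ Q).card + (Q.filter fun x => h * x ∉ Q).card)

/-- Multiplication by `g` maps the points staying in `Q` under `g` bijectively to those staying
under `g⁻¹`. -/
theorem exitRatio_inv_le (Q : Finset G) (g : G) : exitRatio Q g⁻¹ ≤ exitRatio Q g := by
  classical
  have hmaps : ∀ R : Finset G, ∀ k : G, (R.filter fun x => k * x ∈ R).card =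
      (R.filter fun x => k⁻¹ * x ∈ R).card := fun R k => by
    refine Finset.card_bij' (fun x _ => k * x) (fun x _ => k⁻¹ * x) ?_ ?_ ?_ ?_ <;>
      simp +contextual
  have h1 := Finset.card_filter_add_card_filter_not (s := Q) (fun x => g * x ∈ Q)
  have h2 := Finset.card_filter_add_card_filter_not (s := Q) (fun x => g⁻¹ * x ∈ Q)
  rw [← hmaps] at h2
  unfold exitRatio
  rw [show (Q.filter fun x => g⁻¹ * x ∉ Q).card = (Q.filter fun x => g * x ∉ Q).card by omega]

theorem tendsto_exitRatio {P : Finset G} (hgen : Subgroup.closure (P : Set G) = ⊤)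
    {Q : ℕ → Finset G} (hQ : IsFolnerSeq P Q) (g : G) :
    Tendsto (fun n => exitRatio (Q n) g) atTop (𝓝 0) := by
  classical
  have hg : g ∈ Subgroup.closure (P : Set G) := by simp [hgen]
  induction hg using Subgroup.closure_induction with
  | mem g hg =>
    refine squeeze_zero (fun n => exitRatio_nonneg _ _) (fun n => ?_) hQ
    unfold exitRatio
    refine div_le_div_of_nonneg_right (Nat.cast_le.2 ?_) (by positivity)
    refine Finset.card_le_card_of_injOn (fun x => g * x) (fun x hx => ?_)
      fun x _ y _ h => mul_left_cancel h
    simp only [Finset.coe_filter, Set.mem_ofPred_eq] at hx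
    simp only [Finset.coe_sdiff, Set.mem_sdiff, Finset.mem_coe]
    exact ⟨by convert Finset.mul_mem_mul hg hx.1, hx.2⟩
  | one =>
    have : ∀ n, exitRatio (Q n) 1 = 0 := fun n => by
      rw [exitRatio, Finset.filter_false_of_mem (by simp)]
      simp
    simp [this]
  | mul g h _ _ ihg ihh =>
    exact squeeze_zero (fun n => exitRatio_nonneg _ _) (fun n => exitRatio_mul_le _ _ _)
      (by simpa using ihg.add ihh)
  | inv g _ ih =>
    exact squeeze_zero (fun n => exitRatio_nonneg _ _) (fun n => exitRatio_inv_le _ _) ih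

/-- The proportion of points of `Q` moved out of `Q` by some element of `F`. -/
theorem card_filter_exists_exit_le (Q F : Finset G) [DecidablePred fun x => ∃ g ∈ F, g * x ∉ Q] :
    ((Q.filter fun x => ∃ g ∈ F, g * x ∉ Q).card : ℝ) ≤ Q.card * ∑ g ∈ F, exitRatio Q g := by
  classical
  have hsub : (Q.filter fun x => ∃ g ∈ F, g * x ∉ Q) ⊆
      F.biUnion fun g => Q.filter fun x => g * x ∉ Q := fun x hx => by
    simp only [Finset.mem_filter, Finset.mem_biUnion] at hx ⊢
    obtain ⟨hx, g, hg, hgx⟩ := hx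
    exact ⟨g, hg, hx, hgx⟩
  have h := (Finset.card_le_card hsub).trans Finset.card_biUnion_le
  rcases Q.eq_empty_or_nonempty with rfl | hQ
  · simp
  have hQ' : (0 : ℝ) < Q.card := by exact_mod_cast hQ.card_pos
  rw [Finset.mul_sum]
  refine le_trans (Nat.cast_le.2 h) ?_
  rw [Nat.cast_sum]
  refine Finset.sum_le_sum fun g _ => ?_
  rw [exitRatio, mul_div_cancel₀ _ hQ'.ne']

theorem IsMonotile.nonempty {Q : Finset G} (h : IsMonotile Q) : Q.Nonempty := by
  obtain ⟨T, -, hT⟩ := h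
  rw [Finset.nonempty_iff_ne_empty]
  rintro rfl
  have : (1 : G) ∈ (Set.univ : Set G) := trivial
  simp [← hT] at this

theorem IsMonotile.exists_packing {Q : Finset G} (h : IsMonotile Q) :
    ∃ T : Set G, IsPacking Q T ∧ ∀ x, ∃ y ∈ Q, ∃ t ∈ T, x = y * t := by
  obtain ⟨T, hd, hT⟩ := h
  refine ⟨T, fun x hx y hy s hs t ht hxy => ?_, fun x => ?_⟩
  · by_contra hst
    exact Set.disjoint_left.1 (hd hs ht hst) (Set.mul_mem_mul hx rfl)
      (hxy ▸ Set.mul_mem_mul hy rfl)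
  · have hx : x ∈ ⋃ t ∈ T, (Q : Set G) * {t} := hT ▸ Set.mem_univ x
    simp only [Set.mem_iUnion, Set.mem_mul, Set.mem_singleton_iff] at hx
    obtain ⟨t, ht, y, hy, _, rfl, rfl⟩ := hx
    exact ⟨y, hy, _, ht, rfl⟩

open Classical in
/-- The `t ∈ T` with `R t ⊆ A`. -/
def innerTiles (R : Finset G) (T : Set G) (A : Finset G) : Finset T :=
  (R⁻¹ * A).subtype (· ∈ T) |>.filter fun t => ∀ x ∈ R, x * (t : G) ∈ A

theorem mem_innerTiles {R : Finset G} (hR : R.Nonempty) {T : Set G} {A : Finset G} {t : T} :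
    t ∈ innerTiles R T A ↔ ∀ x ∈ R, x * (t : G) ∈ A := by
  classical
  simp only [innerTiles, Finset.mem_filter, Finset.mem_subtype, and_iff_right_iff_imp]
  intro h
  obtain ⟨x, hx⟩ := hR
  convert Finset.mul_mem_mul (Finset.inv_mem_inv hx) (h x hx) using 1
  simp

theorem card_innerTiles_mul_le {R : Finset G} (hR : R.Nonempty) {T : Set G} (hT : IsPacking R T)
    (A : Finset G) : (innerTiles R T A).card * R.card ≤ A.card := by
  classical
  rw [← Finset.card_product]
  refine Finset.card_le_card_of_injOn (fun q => q.2 * (q.1 : G)) (fun q hq => ?_)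
    fun q hq q' hq' h => ?_
  · simp only [Finset.coe_product, Set.mem_prod, Finset.mem_coe] at hq
    exact (mem_innerTiles hR).1 hq.1 _ hq.2
  · simp only [Finset.coe_product, Set.mem_prod, Finset.mem_coe] at hq hq'
    have h1 := hT _ hq.2 _ hq'.2 _ q.1.2 _ q'.1.2 h
    refine Prod.ext (Subtype.ext h1) ?_
    simp only [h1] at h
    exact mul_right_cancel h

-- A point `y * t` of `A` outside all inner tiles has some `z * t ∉ A` with `z ∈ R`, so `z * y⁻¹ ∈ R
-- * R⁻¹` moves it out of `A`.
open Classical in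
theorem card_le_card_innerTiles_mul_add {R : Finset G} (hR : R.Nonempty) {T : Set G}
    (hcov : ∀ x, ∃ y ∈ R, ∃ t ∈ T, x = y * t) (A : Finset G) :
    (A.card : ℝ) ≤ (innerTiles R T A).card * R.card +
      A.card * ∑ g ∈ R * R⁻¹, exitRatio A g := by
  have hsub : A ⊆ ((innerTiles R T A ×ˢ R).image fun q => q.2 * (q.1 : G)) ∪
      A.filter fun x => ∃ g ∈ R * R⁻¹, g * x ∉ A := fun x hx => by
    obtain ⟨y, hy, t, ht, rfl⟩ := hcov x
    by_cases hin : ∀ z ∈ R, z * t ∈ A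
    · exact Finset.mem_union_left _ (Finset.mem_image.2 ⟨(⟨t, ht⟩, y),
        Finset.mem_product.2 ⟨(mem_innerTiles hR).2 hin, hy⟩, rfl⟩)
    · push Not at hin
      obtain ⟨z, hz, hzA⟩ := hin
      refine Finset.mem_union_right _ (Finset.mem_filter.2 ⟨hx, z * y⁻¹,
        Finset.mul_mem_mul hz (Finset.inv_mem_inv hy), ?_⟩)
      simpa [mul_assoc] using hzA
  have h1 := (Finset.card_le_card hsub).trans (Finset.card_union_le _ _)
  have h2 := Finset.card_image_le (s := innerTiles R T A ×ˢ R) (f := fun q => q.2 * (q.1 : G))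
  rw [Finset.card_product] at h2
  have h3 := card_filter_exists_exit_le A (R * R⁻¹)
  have h4 : (A.card : ℝ) ≤ (innerTiles R T A).card * R.card +
      (A.filter fun x => ∃ g ∈ R * R⁻¹, g * x ∉ A).card := by exact_mod_cast h1.trans (by gcongr)
  linarith

theorem tendsto_card_innerTiles {P : Finset G} (hgen : Subgroup.closure (P : Set G) = ⊤)
    {Q : ℕ → Finset G} (hQ : IsFolnerSeq P Q) (hQne : ∀ n, (Q n).Nonempty) {R : Finset G}
    (hR : R.Nonempty) {T : Set G} (hT : IsPacking R T) (hcov : ∀ x, ∃ y ∈ R, ∃ t ∈ T, x = y * t) :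
    Tendsto (fun n => ((innerTiles R T (Q n)).card * R.card : ℝ) / (Q n).card) atTop (𝓝 1) := by
  classical
  have hpos : ∀ n, (0 : ℝ) < (Q n).card := fun n => by exact_mod_cast (hQne n).card_pos
  have hlim : Tendsto (fun n => 1 - ∑ g ∈ R * R⁻¹, exitRatio (Q n) g) atTop (𝓝 1) := by
    have := (tendsto_finsetSum (R * R⁻¹) fun g _ => tendsto_exitRatio hgen hQ g).const_sub 1
    simpa using this
  refine tendsto_of_tendsto_of_tendsto_of_le_of_le hlim tendsto_const_nhds (fun n => ?_) fun n => ?_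
  · rw [le_div_iff₀ (hpos n)]
    have := card_le_card_innerTiles_mul_add hR hcov (Q n)
    linarith
  · refine div_le_one_of_le₀ ?_ (hpos n).le
    exact_mod_cast card_innerTiles_mul_le hR hT (Q n)

/-- The expected number of edges leaving `Q`, per point of `Q`. -/
def boundaryWeight (p : G → unitInterval) (Q : Finset G) : ℝ :=
  ∑' g, (p g : ℝ) * exitRatio Q g

theorem boundaryWeight_nonneg (p : G → unitInterval) (Q : Finset G) : 0 ≤ boundaryWeight p Q :=
  tsum_nonneg fun g => mul_nonneg (p g).2.1 (exitRatio_nonneg Q g)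

/-- Dominated convergence: exit ratios are at most one and tend to zero pointwise, and `p` is
summable. -/
theorem tendsto_boundaryWeight {P : Finset G} (hgen : Subgroup.closure (P : Set G) = ⊤)
    {Q : ℕ → Finset G} (hQ : IsFolnerSeq P Q) {p : G → unitInterval}
    (hs : Summable fun x => (p x : ℝ)) :
    Tendsto (fun n => boundaryWeight p (Q n)) atTop (𝓝 0) := by
  have h := tendsto_tsum_of_dominated_convergence (𝓕 := atTop)
    (f := fun n g => (p g : ℝ) * exitRatio (Q n) g) (g := fun _ => 0) hs
    (fun g => by simpa using (tendsto_exitRatio hgen hQ g).const_mul (p g : ℝ))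
    (Eventually.of_forall fun n g => by
      rw [Real.norm_of_nonneg (mul_nonneg (p g).2.1 (exitRatio_nonneg _ g))]
      exact mul_le_of_le_one_right (p g).2.1 (exitRatio_le_one _ g))
  rw [tsum_zero] at h
  exact h

open Classical in
theorem sum_tsum_indicator_eq {p : G → unitInterval} (hs : Summable fun x => (p x : ℝ))
    {Q : Finset G} (hQ : Q.Nonempty) :
    ∑ x ∈ Q, ∑' g, {g | g * x ∉ Q}.indicator (fun g => (p g : ℝ)) g =
      Q.card * boundaryWeight p Q := by
  rw [← Summable.tsum_finsetSum fun x _ => hs.indicator _, boundaryWeight, ← tsum_mul_left]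
  refine tsum_congr fun g => ?_
  have hQ' : (Q.card : ℝ) ≠ 0 := by exact_mod_cast hQ.card_pos.ne'
  simp only [Set.indicator_apply, Set.mem_ofPred_eq]
  rw [← Finset.sum_filter, Finset.sum_const, nsmul_eq_mul, exitRatio]
  field_simp

end Geometry

/-! ### Decoupling the Laplacian into tiles. -/

section Comparison

open Classical in
/-- The Laplacian of a finite configuration. -/
def patternLaplacian {V : Type*} [Fintype V] (η : Config V) : Matrix V V ℂ :=
  (openGraph η).lapMatrix ℂ

theorem patternLaplacian_isHermitian {V : Type*} [Fintype V] (η : Config V) :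
    (patternLaplacian η).IsHermitian := by
  classical
  exact (openGraph η).isHermitian_lapMatrix ℂ

open Classical in
theorem patternLaplacian_apply {V : Type*} [Fintype V] (η : Config V) (x y : V) :
    patternLaplacian η x y = (if x = y then (((openGraph η).neighborSet x).ncard : ℂ) else 0) -
      (if (openGraph η).Adj x y then 1 else 0) := by
  rw [patternLaplacian, SimpleGraph.lapMatrix, Matrix.sub_apply, SimpleGraph.degMatrix,
    Matrix.diagonal_apply, SimpleGraph.adjMatrix_apply, ← SimpleGraph.card_neighborSet_eq_degree,
    ← Nat.card_coe_set_eq, Nat.card_eq_fintype_card]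

variable {G : Type*} [Group G]

/-- The edges which join a point of an inner tile to a point outside of that tile. -/
def crossingEdges (R : Finset G) (T : Set G) (A : Finset G) : Set (Edge G) :=
  {e | ∃ q ∈ innerTiles R T A ×ˢ R, ∃ g, g * q.2 ∉ R ∧ e.1 = s(q.2 * (q.1 : G), g * (q.2 * q.1))}

/-- Each tile contributes at most `R.card * boundaryWeight p R`, and at most `A.card / R.card` tiles
fit into `A`. -/
theorem sum_crossingEdges_le {p : G → unitInterval} (hp : ∀ x, p x⁻¹ = p x)
    (hs : Summable fun x => (p x : ℝ)) {R : Finset G} (hR : R.Nonempty) {T : Set G}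
    (hT : IsPacking R T) {A : Finset G} (U : Finset (Edge G))
    (hU : (U : Set (Edge G)) ⊆ crossingEdges R T A) :
    ∑ e ∈ U, (edgeProb p hp e.1 : ℝ) ≤ boundaryWeight p R * A.card := by
  have h := sum_edgeProb_le hp hs (X := innerTiles R T A ×ˢ R) (z := fun q => q.2 * (q.1 : G))
    (W := fun q => {g | g * q.2 ∉ R}) U fun e he => hU he
  refine h.trans ?_
  rw [Finset.sum_product]
  simp only [sum_tsum_indicator_eq hs hR]
  rw [Finset.sum_const, nsmul_eq_mul, ← mul_assoc, mul_comm]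
  gcongr
  · exact boundaryWeight_nonneg p R
  · exact_mod_cast card_innerTiles_mul_le hR hT A

/-- If no open edge at the point leaves the tile, its degree inside the tile is its full degree;
this matches the diagonal entries. -/
theorem ncard_neighborSet_tileConfig {R : Finset G} {t : G} {ω : Config G} {x : R}
    (h : ∀ g, (openGraph ω).Adj (x * t) (g * (x * t)) → g * x ∈ R) :
    ((openGraph (tileConfig R t ω)).neighborSet x).ncard =
      ((openGraph ω).neighborSet (x * t)).ncard := by
  have hinj : Function.Injective fun y : R => (y : G) * t := fun y z hyz =>
    Subtype.ext (mul_right_cancel hyz)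
  rw [← Set.ncard_image_of_injective _ hinj]
  congr 1
  ext z
  simp only [Set.mem_image, SimpleGraph.mem_neighborSet]
  constructor
  · rintro ⟨y, hy, rfl⟩
    exact openGraph_tileConfig_adj.1 hy
  · intro hz
    have hzR := h (z * (x * t : G)⁻¹) (by simpa only [inv_mul_cancel_right] using hz)
    refine ⟨⟨z * t⁻¹, by simpa [mul_assoc] using hzR⟩, openGraph_tileConfig_adj.2 ?_, ?_⟩ <;>
      simp [hz]

open Classical in
/-- The restricted Laplacian on `A` is, up to few points, the direct sum of the Laplacians of the
configurations in the tiles. -/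
theorem abs_eigenvalueCount_sub_sum_tiles_le {R : Finset G} (hR : R.Nonempty) {T : Set G}
    (hT : IsPacking R T) {A : Finset G} {ω : Config G} {K : ℝ}
    (hK : ∀ F : Finset (Edge G), (F : Set (Edge G)) ⊆ crossingEdges R T A →
      (∀ e ∈ F, ω e = true) → (F.card : ℝ) ≤ K) (E : ℝ) :
    |(eigenvalueCount (restrictedLaplacian_isHermitian (openGraph ω) A) E : ℝ) -
      ∑ t ∈ innerTiles R T A,
        (eigenvalueCount (patternLaplacian_isHermitian (tileConfig R t ω)) E : ℝ)| ≤
      A.card - (innerTiles R T A).card * R.card + 2 * K := by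
  set I := innerTiles R T A with hI
  let pt : R × I → G := fun q => q.1 * (q.2 : G)
  have hptA : ∀ q, pt q ∈ A := fun q => (mem_innerTiles hR).1 q.2.2 _ q.1.2
  have hpt : Function.Injective pt := fun q q' h => by
    have h1 := hT _ q.1.2 _ q'.1.2 _ q.2.1.2 _ q'.2.1.2 h
    refine Prod.ext (Subtype.ext ?_) (Subtype.ext (Subtype.ext h1))
    simp only [pt, h1] at h
    exact mul_right_cancel h
  let bad : R × I → Prop := fun q => ∃ g, g * (q.1 : G) ∉ R ∧ (openGraph ω).Adj (pt q) (g * pt q)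
  let δ := {q : R × I // ¬ bad q}
  have hgood : ∀ q : δ, ∀ g, (openGraph ω).Adj (pt q.1) (g * pt q.1) → g * q.1.1 ∈ R :=
    fun q g hg => by
      by_contra hgR
      exact q.2 ⟨g, hgR, hg⟩
  let B : Matrix (R × I) (R × I) ℂ :=
    Matrix.blockDiagonal fun t : I => patternLaplacian (tileConfig R (t.1 : G) ω)
  have hB : B.IsHermitian := isHermitian_blockDiagonal fun t => patternLaplacian_isHermitian _
  have hcount : (eigenvalueCount hB E : ℝ) = ∑ t ∈ I,
      (eigenvalueCount (patternLaplacian_isHermitian (tileConfig R t ω)) E : ℝ) := by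
    rw [eigenvalueCount_blockDiagonal fun t : I =>
      patternLaplacian_isHermitian (tileConfig R (t.1 : G) ω), Nat.cast_sum,
      ← Finset.sum_coe_sort I]
  have hcardκ : Fintype.card (R × I) = I.card * R.card := by
    simp [mul_comm]
  -- At points that are not `bad` the degrees agree, and no open edge joins two different tiles.
  have hsub : (restrictedLaplacian (openGraph ω) A).submatrix
      (fun q : δ => (⟨pt q.1, hptA q.1⟩ : A)) (fun q : δ => (⟨pt q.1, hptA q.1⟩ : A)) =
      B.submatrix Subtype.val Subtype.val := by
    ext q q'
    have hBqq : B q.1 q'.1 = if q.1.2 = q'.1.2 then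
        patternLaplacian (tileConfig R (q.1.2.1 : G) ω) q.1.1 q'.1.1 else 0 :=
      Matrix.blockDiagonal_apply _ _ _
    rw [Matrix.submatrix_apply, Matrix.submatrix_apply, restrictedLaplacian_apply, hBqq]
    have heq : ((⟨pt q.1, hptA q.1⟩ : A) = ⟨pt q'.1, hptA q'.1⟩) ↔ q = q' := by
      rw [Subtype.mk.injEq, hpt.eq_iff, Subtype.ext_iff]
    simp only [heq]
    by_cases ht : q.1.2 = q'.1.2
    · rw [if_pos ht, patternLaplacian_apply, openGraph_tileConfig_adj,
        ncard_neighborSet_tileConfig (hgood q)]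
      have hx : q.1.1 = q'.1.1 ↔ q = q' :=
        ⟨fun h => Subtype.ext (Prod.ext h ht), fun h => by rw [h]⟩
      simp only [hx, pt, ht]
    · have hne : q ≠ q' := fun h => ht (by rw [h])
      rw [if_neg ht, if_neg hne, if_neg, sub_zero]
      intro hadj
      have h1 := hgood q (pt q'.1 * (pt q.1)⁻¹) (by simpa using hadj)
      refine ht (Subtype.ext (Subtype.ext (hT _ h1 _ q'.1.1.2 _ q.1.2.1.2 _ q'.1.2.1.2 ?_)))
      simp [pt, mul_assoc]
  have hcount2 := abs_eigenvalueCount_sub_le (restrictedLaplacian_isHermitian (openGraph ω) A) hB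
    (e := fun q : δ => (⟨pt q.1, hptA q.1⟩ : A)) (f := Subtype.val)
    (fun q q' h => Subtype.ext (hpt (Subtype.mk.inj h))) Subtype.val_injective hsub
    (by rw [hcardκ, Fintype.card_coe]; exact card_innerTiles_mul_le hR hT A) E
  rw [hcount] at hcount2
  refine hcount2.trans ?_
  have hbad : ((Finset.univ.filter bad).card : ℝ) ≤ 2 * K := by
    have hex : ∀ q, bad q → ∃ e : Edge G, ω e = true ∧ e ∈ crossingEdges R T A ∧ pt q ∈ e.1 := by
      rintro q ⟨g, hg, hadj⟩
      obtain ⟨he, hω⟩ := hadj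
      exact ⟨⟨_, he⟩, hω, ⟨((q.2 : T), (q.1 : G)), Finset.mem_product.2 ⟨q.2.2, q.1.2⟩, g, hg, rfl⟩,
        Sym2.mem_mk_left _ _⟩
    rcases (Finset.univ.filter bad).eq_empty_or_nonempty with h0 | ⟨q₀, hq₀⟩
    · have := hK ∅ (by simp) (by simp)
      rw [h0]
      simpa using this
    have : Nonempty (Edge G) := ⟨(hex q₀ (Finset.mem_filter.1 hq₀).2).choose⟩
    choose! ed hed1 hed2 hed3 using hex
    -- An edge has two endpoints, so it is chosen by at most two bad points.
    have h1 := Finset.card_le_mul_card_image (f := ed) (Finset.univ.filter bad) 2 fun e he => by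
      refine (Finset.card_le_card_of_injOn (t := e.1.toFinset) pt (fun q hq => ?_)
        hpt.injOn).trans ?_
      · simp only [Finset.coe_filter, Finset.mem_filter, Finset.mem_univ, true_and,
          Set.mem_ofPred_eq] at hq
        simpa [← hq.2] using hed3 q hq.1
      · rw [Sym2.card_toFinset]
        split_ifs <;> norm_num
    have h2 := hK ((Finset.univ.filter bad).image ed) (fun e he => by
      simp only [Finset.coe_image, Finset.coe_filter, Set.mem_image, Set.mem_ofPred_eq] at he
      obtain ⟨q, hq, rfl⟩ := he
      exact hed2 q hq.2) fun e he => by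
        simp only [Finset.mem_image, Finset.mem_filter] at he
        obtain ⟨q, hq, rfl⟩ := he
        exact hed1 q hq.2
    have h3 : ((Finset.univ.filter bad).card : ℝ) ≤
      2 * ((Finset.univ.filter bad).image ed).card := by exact_mod_cast h1
    linarith
  have hδ : (Fintype.card δ : ℝ) = I.card * R.card - (Finset.univ.filter bad).card := by
    have h1 := Fintype.card_subtype_compl bad
    have h2 := Fintype.card_subtype_le bad
    rw [hcardκ] at h1 h2
    rw [h1, Nat.cast_sub h2, Fintype.card_subtype]
    push_cast
    ring
  rw [hδ, Fintype.card_coe]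
  linarith

end Comparison

/-! ### Almost sure uniform approximation and existence of the IDS. -/

section Approximation

/-- Makes bounds exponentially small in `(Q n).card` summable, as Borel–Cantelli requires. -/
theorem IsStrictlyIncreasing.le_card {G : Type*} {Q : ℕ → Finset G} (h : IsStrictlyIncreasing Q) (n : ℕ) :
    (n : ℝ) ≤ (Q n).card :=
  Nat.cast_le.2 ((strictMono_nat_of_lt_succ h).le_apply)

theorem tsum_ofReal_ne_top_of_le_exp {f : ℕ → ENNReal} {K c : ℝ} (hc : 0 < c)
    (hf : ∀ n, f n ≤ ENNReal.ofReal (K * Real.exp (-c * n))) : ∑' n, f n ≠ ⊤ := by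
  refine ne_top_of_le_ne_top ?_ (ENNReal.tsum_le_tsum hf)
  have hs : Summable fun n : ℕ => Real.exp (-c * n) := by
    simpa only [mul_comm] using Real.summable_exp_nat_mul_iff.2 (neg_lt_zero.2 hc)
  exact (hs.mul_left K).tsum_ofReal_ne_top

variable {G : Type*} [Group G] {p : G → unitInterval} (hp : ∀ x, p x⁻¹ = p x)

open Classical in
/-- The expected normalised eigenvalue count of the Laplacian of the configuration in `R`. -/
def approxIDS (R : Finset G) (E : ℝ) : ℝ :=
  (∑ η : Config R, (bondMeasure (tileProb p hp R)).real {η} *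
    (eigenvalueCount (patternLaplacian_isHermitian η) E : ℝ)) / R.card

theorem ae_eventually_card_crossing_le [Countable G] (hs : Summable fun x => (p x : ℝ))
    {Q : ℕ → Finset G} (hinc : IsStrictlyIncreasing Q) {R : Finset G} (hR : R.Nonempty)
    {T : Set G} (hT : IsPacking R T) {c : ℝ} (hc : Real.exp 1 * boundaryWeight p R < c) :
    ∀ᵐ ω ∂(percMeasure p hp), ∀ᶠ n in atTop, ∀ F : Finset (Edge G),
      (F : Set (Edge G)) ⊆ crossingEdges R T (Q n) → (∀ e ∈ F, ω e = true) →
        (F.card : ℝ) ≤ c * (Q n).card := by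
  have hb := boundaryWeight_nonneg p R
  -- Any larger open family contains one of exactly this size. The gap between `c` and `exp 1 *
  -- boundaryWeight p R` is the rate of exponential decay.
  let s : ℕ → Set (Config G) := fun n => {ω | ∃ F : Finset (Edge G),
    (F : Set (Edge G)) ⊆ crossingEdges R T (Q n) ∧ F.card = ⌈c * (Q n).card⌉₊ ∧ ∀ e ∈ F, ω e = true}
  have hsum : ∑' n, percMeasure p hp (s n) ≠ ⊤ := by
    refine tsum_ofReal_ne_top_of_le_exp (K := 1) (sub_pos.2 hc) fun n => ?_
    rw [percMeasure_eq]
    refine (bondMeasure_exists_card_le _ _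
      (fun U hU => sum_crossingEdges_le hp hs hR hT U hU) _).trans ?_
    refine ENNReal.ofReal_le_ofReal ?_
    rw [one_mul]
    refine Real.exp_le_exp.2 ?_
    have h1 := Nat.le_ceil (c * (Q n).card)
    have h2 := mul_le_mul_of_nonneg_left (hinc.le_card n) (sub_pos.2 hc).le
    linarith
  filter_upwards [ae_eventually_notMem hsum] with ω hω
  filter_upwards [hω] with n hn F hF hopen
  by_contra! hlt
  obtain ⟨F', hF', hcard⟩ := Finset.exists_subset_card_eq (Nat.ceil_le.2 hlt.le)
  exact hn ⟨F', (Finset.coe_subset.2 hF').trans hF, hcard, fun e he => hopen e (hF' he)⟩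

open Classical in
theorem ae_eventually_pattern_count {Q : ℕ → Finset G} (hinc : IsStrictlyIncreasing Q)
    {R : Finset G} (hR : R.Nonempty) {T : Set G} (hT : IsPacking R T) {ε : ℝ} (hε : 0 < ε) :
    ∀ᵐ ω ∂(percMeasure p hp), ∀ᶠ n in atTop, ∀ η : Config R,
      |∑ t ∈ innerTiles R T (Q n), (({η} : Set (Config R)).indicator 1 (tileConfig R (t : G) ω) -
        (bondMeasure (tileProb p hp R)).real {η})| ≤ ε * (Q n).card := by
  simp only [eventually_all]
  intro η
  have hsum : ∑' n, percMeasure p hp {ω | ε * (Q n).card ≤ |∑ t ∈ innerTiles R T (Q n),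
      (({η} : Set (Config R)).indicator 1 (tileConfig R (t : G) ω) -
        (bondMeasure (tileProb p hp R)).real {η})|} ≠ ⊤ := by
    refine tsum_ofReal_ne_top_of_le_exp (K := 2) (c := 2 * ε ^ 2) (by positivity) fun n => ?_
    rw [← ofReal_measureReal]
    refine ENNReal.ofReal_le_ofReal ?_
    have hcard : ((innerTiles R T (Q n)).card : ℝ) ≤ (Q n).card := by
      have h1 := card_innerTiles_mul_le hR hT (Q n)
      have h2 := hR.card_pos
      exact_mod_cast (Nat.le_mul_of_pos_right _ h2).trans h1
    refine (bondMeasure_pattern_count (fun e : Edge G => edgeProb p hp e.1)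
      (f := fun (t : T) e => tileEdge R (t : G) e) (tileProb p hp R)
      (tileEdge_injective hT) (fun t e => edgeProb_tileEdge p hp R t e) η
      (innerTiles R T (Q n)) hcard hε).trans ?_
    refine mul_le_mul_of_nonneg_left (Real.exp_le_exp.2 ?_) zero_le_two
    have := mul_le_mul_of_nonneg_left (hinc.le_card n) (sq_nonneg ε)
    linarith
  filter_upwards [ae_eventually_notMem hsum] with ω hω
  filter_upwards [hω] with n hn
  exact (not_le.1 hn).le

theorem sum_bondMeasure_singleton {β : Type*} [Fintype β] [DecidableEq β] (q : β → unitInterval) :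
    ∑ η : β → Bool, (bondMeasure q).real {η} = 1 := by
  simp

-- Three errors add up: decoupling into tiles, fluctuation of pattern frequencies, and replacing the
-- number of tiles by `A.card / R.card`. The uncovered proportion enters the first and the third,
-- hence the factor `2`.
open Classical in
theorem abs_normalizedCount_sub_approxIDS_le {A R : Finset G} (hA : A.Nonempty) (hR : R.Nonempty)
    {T : Set G} (hT : IsPacking R T) {ω : Config G} {c ε : ℝ}
    (hc : ∀ F : Finset (Edge G), (F : Set (Edge G)) ⊆ crossingEdges R T A →
      (∀ e ∈ F, ω e = true) → (F.card : ℝ) ≤ c * A.card)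
    (hε : ∀ η : Config R, |∑ t ∈ innerTiles R T A, (({η} : Set (Config R)).indicator 1 (tileConfig R (t : G) ω) -
        (bondMeasure (tileProb p hp R)).real {η})| ≤ ε * A.card) (E : ℝ) :
    |normalizedCount ω A E - approxIDS hp R E| ≤
      2 * (1 - (innerTiles R T A).card * R.card / A.card) + 2 * c +
        Fintype.card (Config R) * R.card * ε := by
  have ha : (0 : ℝ) < A.card := by exact_mod_cast hA.card_pos
  have hr : (0 : ℝ) < R.card := by exact_mod_cast hR.card_pos
  set I := innerTiles R T A
  set w : Config R → ℝ := fun η => (bondMeasure (tileProb p hp R)).real {η} with hw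
  set N : Config R → ℝ := fun η => (eigenvalueCount (patternLaplacian_isHermitian η) E : ℝ) with hN
  set X : ℝ :=
    ((eigenvalueCount (restrictedLaplacian_isHermitian (openGraph ω) A) E : ℕ) : ℝ) with hX
  have hN0 : ∀ η, 0 ≤ N η := fun η => by positivity
  have hNr : ∀ η, N η ≤ R.card := fun η => by
    have := eigenvalueCount_le_card (patternLaplacian_isHermitian η) E
    rw [Fintype.card_coe] at this
    exact Nat.cast_le.2 this
  have hir : (I.card : ℝ) * R.card ≤ A.card := by exact_mod_cast card_innerTiles_mul_le hR hT A
  have h1 : |X - ∑ t ∈ I, N (tileConfig R t ω)| ≤ A.card - I.card * R.card + 2 * (c * A.card) :=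
    abs_eigenvalueCount_sub_sum_tiles_le hR hT hc E
  have h2 : |∑ t ∈ I, N (tileConfig R t ω) - I.card * ∑ η, w η * N η| ≤
      Fintype.card (Config R) * (ε * A.card * R.card) := by
    have heq : ∑ t ∈ I, N (tileConfig R t ω) - I.card * ∑ η, w η * N η =
        ∑ η, (∑ t ∈ I, (({η} : Set (Config R)).indicator 1 (tileConfig R (t : G) ω) - w η)) * N η := by
      simp only [Finset.sum_mul, sub_mul, Finset.sum_sub_distrib, Finset.sum_const, nsmul_eq_mul]
      rw [Finset.sum_comm, Finset.mul_sum]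
      congr 1
      · refine Finset.sum_congr rfl fun t _ => ?_
        simp [Set.indicator_apply]
      · exact Finset.sum_congr rfl fun η _ => (mul_assoc _ _ _).symm
    rw [heq]
    refine (Finset.abs_sum_le_sum_abs _ _).trans ?_
    refine (Finset.sum_le_card_nsmul Finset.univ _ (ε * A.card * R.card) fun η _ => ?_).trans_eq ?_
    · rw [abs_mul, abs_of_nonneg (hN0 η)]
      exact mul_le_mul (hε η) (hNr η) (hN0 η) ((abs_nonneg _).trans (hε η))
    · rw [Finset.card_univ, nsmul_eq_mul]
  have hZ : ∑ η, w η * N η ≤ R.card := by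
    calc ∑ η, w η * N η ≤ ∑ η, w η * R.card :=
          Finset.sum_le_sum fun η _ => mul_le_mul_of_nonneg_left (hNr η) measureReal_nonneg
      _ = R.card := by rw [← Finset.sum_mul, sum_bondMeasure_singleton, one_mul]
  have hZ0 : 0 ≤ ∑ η, w η * N η :=
    Finset.sum_nonneg fun η _ => mul_nonneg measureReal_nonneg (hN0 η)
  set Z := ∑ η, w η * N η with hZdef
  have h3 : |I.card * Z - A.card * (Z / R.card)| ≤ A.card - I.card * R.card := by
    have : I.card * Z - A.card * (Z / R.card) = -((A.card - I.card * R.card) * (Z / R.card)) := by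
      field_simp
      ring
    rw [this, abs_neg, abs_of_nonneg (mul_nonneg (sub_nonneg.2 hir) (by positivity))]
    exact mul_le_of_le_one_right (sub_nonneg.2 hir) (div_le_one_of_le₀ hZ hr.le)
  have h4 : |X - A.card * (Z / R.card)| ≤ 2 * (A.card - I.card * R.card) + 2 * (c * A.card) +
      Fintype.card (Config R) * (ε * A.card * R.card) := by
    have e1 := abs_sub_le X (∑ t ∈ I, N (tileConfig R t ω)) (A.card * (Z / R.card))
    have e2 := abs_sub_le (∑ t ∈ I, N (tileConfig R t ω)) (I.card * Z) (A.card * (Z / R.card))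
    linarith
  have h5 : normalizedCount ω A E - approxIDS hp R E = (X - A.card * (Z / R.card)) / A.card := by
    rw [sub_div, mul_div_cancel_left₀ _ ha.ne']
    rfl
  rw [h5, abs_div, abs_of_pos ha, div_le_iff₀ ha]
  refine h4.trans_eq ?_
  field_simp

theorem ae_eventually_abs_normalizedCount_sub_le [Countable G] (hs : Summable fun x => (p x : ℝ))
    {P : Finset G} (hgen : Subgroup.closure (P : Set G) = ⊤) {Q : ℕ → Finset G}
    (hQ : IsFolnerSeq P Q) (hinc : IsStrictlyIncreasing Q) (hQt : ∀ n, IsMonotile (Q n))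
    {R : Finset G} (hR : IsMonotile R) {δ : ℝ} (hδ : 0 < δ) :
    ∀ᵐ ω ∂(percMeasure p hp), ∀ᶠ n in atTop, ∀ E,
      |normalizedCount ω (Q n) E - approxIDS hp R E| ≤ 6 * boundaryWeight p R + δ := by
  classical
  have hRne := hR.nonempty
  obtain ⟨T, hT, hcov⟩ := hR.exists_packing
  have hr : (0 : ℝ) < R.card := by exact_mod_cast hRne.card_pos
  have hC : (0 : ℝ) < Fintype.card (Config R) := by exact_mod_cast Fintype.card_pos
  have htiles := tendsto_card_innerTiles hgen hQ (fun n => (hQt n).nonempty) hRne hT hcov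
  filter_upwards [ae_eventually_card_crossing_le hp hs hinc hRne hT
      (c := Real.exp 1 * boundaryWeight p R + δ / 8) (by linarith),
    ae_eventually_pattern_count hp hinc hRne hT
      (ε := δ / 4 / (Fintype.card (Config R) * R.card)) (by positivity)] with ω h1 h2
  filter_upwards [h1, h2, htiles.eventually (lt_mem_nhds (show 1 - δ / 8 < 1 by linarith))]
    with n hn1 hn2 hn3 E
  refine (abs_normalizedCount_sub_approxIDS_le hp (hQt n).nonempty hRne hT hn1 hn2 E).trans ?_
  rw [mul_div_cancel₀ _ (by positivity)]
  -- Since `exp 1 < 3`, the crossing term is at most `6 * boundaryWeight p R + δ / 4`; the other two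
  -- are at most `δ / 4` each.
  have := mul_le_mul_of_nonneg_right Real.exp_one_lt_three.le (boundaryWeight_nonneg p R)
  linarith

/-- The integrated density of states exists and is uniformly approximated by the finite-volume
expectations. -/
theorem exists_isIDS (hp0 : ∀ x, 0 < (p x : ℝ)) (hs : Summable fun x => (p x : ℝ))
    {P : Finset G} (hgen : Subgroup.closure (P : Set G) = ⊤) {Q : ℕ → Finset G}
    (hQ : IsFolnerSeq P Q) (hinc : IsStrictlyIncreasing Q) (hQt : ∀ n, IsMonotile (Q n)) :
    ∃ N : ℝ → ℝ, IsIDS p hp Q N ∧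
      ∀ m E, |N E - approxIDS hp (Q m) E| ≤ 6 * boundaryWeight p (Q m) := by
  have := countable_of_summable hp0 hs
  have hb : Tendsto (fun m => 6 * boundaryWeight p (Q m)) atTop (𝓝 0) := by
    simpa using (tendsto_boundaryWeight hgen hQ hs).const_mul 6
  have hae : ∀ᵐ ω ∂(percMeasure p hp), ∀ m k : ℕ, ∀ᶠ n in atTop, ∀ E,
      |normalizedCount ω (Q n) E - approxIDS hp (Q m) E| ≤
        6 * boundaryWeight p (Q m) + 1 / ((k : ℝ) + 1) := by
    rw [ae_all_iff]
    intro m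
    rw [ae_all_iff]
    intro k
    exact ae_eventually_abs_normalizedCount_sub_le hp hs hgen hQ hinc hQt (hQt m) (by positivity)
  have hclose : ∀ ω : Config G, (∀ m k : ℕ, ∀ᶠ n in atTop, ∀ E,
      |normalizedCount ω (Q n) E - approxIDS hp (Q m) E| ≤
        6 * boundaryWeight p (Q m) + 1 / ((k : ℝ) + 1)) → ∀ ε > 0, ∃ m, ∀ᶠ n in atTop, ∀ E,
      |normalizedCount ω (Q n) E - approxIDS hp (Q m) E| < ε ∧
        6 * boundaryWeight p (Q m) < ε := fun ω hω ε hε => by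
    obtain ⟨m, hm⟩ := (hb.eventually (gt_mem_nhds (half_pos hε))).exists
    obtain ⟨k, hk⟩ := exists_nat_one_div_lt (half_pos hε)
    refine ⟨m, (hω m k).mono fun n hn E => ⟨(hn E).trans_lt (by linarith), by linarith⟩⟩
  -- A single good configuration defines `N`; since `approxIDS` is deterministic, every other good
  -- configuration has the same limit.
  obtain ⟨ω₀, hω₀⟩ := hae.exists
  have hcauchy : ∀ E, CauchySeq fun n => normalizedCount ω₀ (Q n) E := fun E => by
    rw [Metric.cauchySeq_iff']
    intro ε hε
    obtain ⟨m, hm⟩ := hclose ω₀ hω₀ (ε / 2) (half_pos hε)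
    obtain ⟨n₀, hn₀⟩ := eventually_atTop.1 hm
    refine ⟨n₀, fun n hn => ?_⟩
    have h1 := (hn₀ n hn E).1
    have h2 := (hn₀ n₀ le_rfl E).1
    rw [abs_lt] at h1 h2
    rw [Real.dist_eq, abs_lt]
    constructor <;> linarith
  choose N hN using fun E => cauchySeq_tendsto_of_complete (hcauchy E)
  have hbound : ∀ m E, |N E - approxIDS hp (Q m) E| ≤ 6 * boundaryWeight p (Q m) := fun m E => by
    refine le_of_forall_pos_le_add fun ε hε => ?_
    obtain ⟨k, hk⟩ := exists_nat_one_div_lt hε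
    refine le_of_tendsto ((hN E).sub_const _).abs ((hω₀ m k).mono fun n hn => (hn E).trans ?_)
    linarith
  refine ⟨N, ?_, hbound⟩
  filter_upwards [hae, ae_locallyFinite hp hs] with ω hω hfin
  refine ⟨hfin, Metric.tendstoUniformly_iff.2 fun ε hε => ?_⟩
  obtain ⟨m, hm⟩ := hclose ω hω (ε / 2) (half_pos hε)
  filter_upwards [hm] with n hn E
  have h1 := hn E
  have h2 := hbound m E
  rw [abs_lt] at h1
  rw [abs_le] at h2
  rw [Real.dist_eq, abs_lt]
  constructor <;> linarith

end Approximation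

/-! ### Spectra of finite subgraphs. -/

section Spectra

theorem lapMatrix_mulVec_eq_sum {V : Type*} [Fintype V] [DecidableEq V] (H : SimpleGraph V)
    [DecidableRel H.Adj] (v : V → ℂ) (x : V) :
    (H.lapMatrix ℂ).mulVec v x = ∑ y, (if H.Adj x y then v x - v y else 0) := by
  rw [SimpleGraph.lapMatrix_mulVec_apply, ← Finset.sum_filter,
    ← SimpleGraph.neighborFinset_eq_filter, Finset.sum_sub_distrib, Finset.sum_const,
    SimpleGraph.card_neighborFinset_eq_degree, nsmul_eq_mul]

/-- The pointwise eigenvalue equation transports easily along bijections of vertex sets and under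
extension by zero. -/
theorem mem_spectrum_lapMatrix_iff {V : Type*} [Fintype V] [DecidableEq V] (H : SimpleGraph V)
    [DecidableRel H.Adj] (z : ℂ) : z ∈ spectrum ℂ (H.lapMatrix ℂ) ↔
      ∃ v : V → ℂ, v ≠ 0 ∧ ∀ x, ∑ y, (if H.Adj x y then v x - v y else 0) = z * v x := by
  rw [← Matrix.spectrum_toLin', ← Module.End.hasEigenvalue_iff_mem_spectrum]
  constructor
  · intro h
    obtain ⟨v, hv⟩ := h.exists_hasEigenvector
    refine ⟨v, hv.2, fun x => ?_⟩
    rw [← lapMatrix_mulVec_eq_sum, ← Matrix.toLin'_apply, hv.apply_eq_smul]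
    rfl
  · rintro ⟨v, hv0, hv⟩
    refine Module.End.hasEigenvalue_of_hasEigenvector (x := v)
      ⟨Module.End.mem_eigenspace_iff.2 (funext fun x => ?_), hv0⟩
    rw [Matrix.toLin'_apply, lapMatrix_mulVec_eq_sum, hv]
    rfl

theorem isAlgebraic_of_mem_finiteSubgraphSpectra {G : Type*} {lam : ℝ}
    (h : lam ∈ finiteSubgraphSpectra G) : IsAlgebraic ℚ lam := by
  classical
  obtain ⟨S, hS, hlam⟩ := h
  refine isAlgebraic_of_mem_spectrum_map (S.coe.lapMatrix ℚ) ?_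
  convert hlam using 2
  ext x y
  simp only [SimpleGraph.lapMatrix, SimpleGraph.degMatrix, Matrix.map_apply, Matrix.sub_apply,
    Matrix.diagonal_apply, SimpleGraph.adjMatrix_apply]
  split_ifs <;> simp

/-- The finite subgraph of the complete graph given by the open edges of a finite
configuration. -/
def patternSubgraph {G : Type*} {R : Finset G} (η : Config R) : (⊤ : SimpleGraph G).Subgraph where
  verts := R
  Adj x y := ∃ (hx : x ∈ R) (hy : y ∈ R), (openGraph η).Adj ⟨x, hx⟩ ⟨y, hy⟩
  adj_sub := by
    rintro x y ⟨hx, hy, h⟩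
    exact fun hxy => h.ne (Subtype.ext hxy)
  edge_vert := fun ⟨hx, _, _⟩ => hx
  symm := ⟨fun _ _ ⟨hx, hy, h⟩ => ⟨hy, hx, h.symm⟩⟩

open Classical in
theorem mem_finiteSubgraphSpectra_of_mem_spectrum {G : Type*} {R : Finset G} (η : Config R)
    {lam : ℝ} (h : (lam : ℂ) ∈ spectrum ℂ (patternLaplacian η)) :
    lam ∈ finiteSubgraphSpectra G := by
  obtain ⟨v, hv0, hv⟩ := (mem_spectrum_lapMatrix_iff (openGraph η) (lam : ℂ)).1 (by
    convert h
    rw [patternLaplacian]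
    convert rfl)
  let e : (patternSubgraph η).verts ≃ R := Equiv.refl _
  have hadj : ∀ x y, (patternSubgraph η).coe.Adj x y ↔ (openGraph η).Adj (e x) (e y) :=
    fun x y => ⟨fun ⟨_, _, h⟩ => h, fun h => ⟨x.2, y.2, h⟩⟩
  let hfin : Fintype (patternSubgraph η).verts := Fintype.ofEquiv R e.symm
  refine ⟨patternSubgraph η, hfin, ?_⟩
  refine (mem_spectrum_lapMatrix_iff _ _).2 ⟨v ∘ e, fun h0 => hv0 ?_, fun x => ?_⟩
  · funext x
    exact congrFun h0 (e.symm x)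
  · rw [Function.comp_apply, ← hv (e x)]
    refine Fintype.sum_equiv e _ _ fun y => ?_
    simp only [hadj, Function.comp_apply]

variable {G : Type*} [Group G] {p : G → unitInterval} (hp : ∀ x, p x⁻¹ = p x)

theorem continuousAt_approxIDS (R : Finset G) {lam : ℝ} (h : lam ∉ finiteSubgraphSpectra G) :
    ContinuousAt (approxIDS hp R) lam := by
  classical
  unfold approxIDS
  refine ContinuousAt.div_const (tendsto_finsetSum _ fun η _ => ContinuousAt.const_mul ?_ _) _
  exact continuousAt_eigenvalueCount _ fun hlam =>
    h (mem_finiteSubgraphSpectra_of_mem_spectrum η hlam)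

end Spectra

/-! ### Isolated copies of a finite graph and the jumps they cause. -/

section IsolatedCopies

/-- One rate `C` bounds all factors of closed edges, and of the finitely many types of open edges,
from below. Their product is then at least `exp (-C * ∑ p)`, however many edges must be closed. -/
theorem exists_exp_neg_mul_le {α : Type*} {f : α → ℝ} (h0 : ∀ x, 0 < f x) (h1 : ∀ x, f x < 1)
    (hs : Summable f) (K : Finset α) :
    ∃ C, 0 ≤ C ∧ (∀ x, Real.exp (-C * f x) ≤ 1 - f x) ∧ ∀ x ∈ K, Real.exp (-C * f x) ≤ f x := by
  have hlim : ∀ x, Tendsto (fun C : ℝ => Real.exp (-C * f x)) atTop (𝓝 0) := fun x =>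
    Real.tendsto_exp_atBot.comp (tendsto_neg_atTop_atBot.atBot_mul_const (h0 x))
  have hfin : {x | ¬ f x < 1 / 2}.Finite :=
    hs.tendsto_cofinite_zero.eventually (gt_mem_nhds (by norm_num : (0 : ℝ) < 1 / 2))
  have hA : ∀ᶠ C in atTop, ∀ x ∈ {x | ¬ f x < 1 / 2}, Real.exp (-C * f x) ≤ 1 - f x :=
    (eventually_all_finite hfin).2 fun x _ => ((hlim x).eventually
      (gt_mem_nhds (sub_pos.2 (h1 x)))).mono fun _ h => h.le
  have hB : ∀ᶠ C in atTop, ∀ x ∈ K, Real.exp (-C * f x) ≤ f x :=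
    (eventually_all_finset K).2 fun x _ => ((hlim x).eventually
      (gt_mem_nhds (h0 x))).mono fun _ h => h.le
  obtain ⟨C, ⟨hCA, hCB⟩, hC2⟩ := ((hA.and hB).and (eventually_ge_atTop 2)).exists
  refine ⟨C, by linarith, fun x => ?_, hCB⟩
  -- For small values `1 - f ≥ exp (-2 f)`, so `C ≥ 2` suffices; summability leaves finitely many
  -- others, absorbed by a large `C`.
  by_cases hx : f x < 1 / 2
  · have hpos : 0 < 1 - f x := by linarith
    have hlog := Real.one_sub_inv_le_log_of_pos hpos
    rw [← Real.le_log_iff_exp_le hpos]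
    refine le_trans ?_ hlog
    have h2 : (1 - f x)⁻¹ ≤ 1 + 2 * f x := by
      rw [inv_le_iff_one_le_mul₀ hpos]
      nlinarith [h0 x]
    nlinarith [h0 x]
  · exact hCA x hx

variable {G : Type*} [Group G]

/-- The translate by `s` of the graph with adjacency relation `adj` on `V` lies in `R` and is a
union of components of the configuration `η`. -/
def IsIsolatedCopy (V : Finset G) (adj : G → G → Prop) (R : Finset G) (s : G) (η : Config R) :
    Prop :=
  ∀ x y : R, (x : G) * s⁻¹ ∈ V → ((openGraph η).Adj x y ↔ adj (x * s⁻¹) (y * s⁻¹))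

theorem sum_translate_eq {M : Type*} [AddCommMonoid M] {V R : Finset G} {s : G}
    (hV : ∀ u ∈ V, u * s ∈ R) {F : G → M} (hF : ∀ u, u ∉ V → F u = 0) :
    ∑ y : R, F (y * s⁻¹) = ∑ u ∈ V, F u := by
  classical
  rw [Finset.sum_coe_sort R fun y => F (y * s⁻¹),
    ← Finset.sum_subset (s₁ := V.image (· * s)) (Finset.image_subset_iff.2 hV),
    Finset.sum_image fun x _ y _ h => mul_right_cancel h]
  · simp
  · intro x _ hx
    refine hF _ fun hxV => hx (Finset.mem_image.2 ⟨_, hxV, by simp⟩)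

variable {V : Finset G} {adj : G → G → Prop}

-- No edge joins the copy to its complement, so the extension by zero of an eigenfunction remains an
-- eigenfunction.
open Classical in
theorem patternLaplacian_mulVec_translate (hsymm : ∀ x y, adj x y → adj y x)
    (hV : ∀ x y, adj x y → x ∈ V) {w : G → ℂ} (hw : ∀ u, u ∉ V → w u = 0) {lam : ℝ}
    (heig : ∀ x ∈ V, ∑ y ∈ V, (if adj x y then w x - w y else 0) = lam * w x)
    {R : Finset G} {s : G} (hs : ∀ u ∈ V, u * s ∈ R) {η : Config R}
    (hη : IsIsolatedCopy V adj R s η) :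
    (patternLaplacian η).mulVec (fun x : R => w (x * s⁻¹)) =
      (lam : ℂ) • fun x : R => w (x * s⁻¹) := by
  funext x
  have hmul : (patternLaplacian η).mulVec (fun x : R => w (x * s⁻¹)) x =
      ∑ y : R, (if (openGraph η).Adj x y then w (x * s⁻¹) - w (y * s⁻¹) else 0) := by
    rw [patternLaplacian]
    convert lapMatrix_mulVec_eq_sum (openGraph η) (fun x : R => w (x * s⁻¹)) x
  rw [hmul, Pi.smul_apply, smul_eq_mul]
  by_cases hx : (x : G) * s⁻¹ ∈ V
  · simp only [hη x _ hx]
    rw [← heig _ hx]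
    exact sum_translate_eq (F := fun u => if adj (x * s⁻¹) u then w (x * s⁻¹) - w u else 0) hs
      fun u hu => if_neg fun h => hu (hV _ _ (hsymm _ _ h))
  · rw [hw _ hx, mul_zero]
    refine Finset.sum_eq_zero fun y _ => ?_
    split_ifs with hxy
    · have hy : (y : G) * s⁻¹ ∉ V := fun hy => hx (hV _ _ (hsymm _ _ ((hη y x hy).1 hxy.symm)))
      rw [hw _ hy, sub_zero]
    · rfl

variable {p : G → unitInterval} (hp : ∀ x, p x⁻¹ = p x)

/-- A fixed finite graph occurs as an isolated piece with probability bounded below, uniformly in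
the surrounding volume. -/
theorem exists_le_measure_isIsolatedCopy (hp0 : ∀ x, 0 < (p x : ℝ)) (hp1 : ∀ x, (p x : ℝ) < 1)
    (hs : Summable fun x => (p x : ℝ)) (hsymm : ∀ x y, adj x y → adj y x)
    (hV : ∀ x y, adj x y → x ∈ V) (hirr : ∀ x, ¬ adj x x) :
    ∃ c, 0 < c ∧ ∀ (R : Finset G) (s : G),
      c ≤ (bondMeasure (tileProb p hp R)).real {η | IsIsolatedCopy V adj R s η} := by
  classical
  obtain ⟨C, hC0, hC1, hC2⟩ := exists_exp_neg_mul_le hp0 hp1 hs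
    ((V ×ˢ V).image fun q => q.1 * q.2⁻¹)
  refine ⟨Real.exp (-C * (V.card * ∑' g, (p g : ℝ))), Real.exp_pos _, fun R s => ?_⟩
  -- Only the edges of `R` touching the copy are prescribed. Their total weight is at most `V.card`
  -- times the sum of `p`, whatever `R` and `s` are.
  let F : Finset (Edge R) := Finset.univ.filter fun e => ∃ x ∈ e.1, (x : G) * s⁻¹ ∈ V
  let f : Edge R → Bool := fun e =>
    decide (∃ x y : R, e.1 = s(x, y) ∧ adj (x * s⁻¹) (y * s⁻¹))
  have hcyl : {η : Config R | ∀ e ∈ F, η e = f e} ⊆ {η | IsIsolatedCopy V adj R s η} := by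
    intro η hη x y hx
    by_cases hxy : x = y
    · subst hxy
      simp [hirr]
    · rw [openGraph_adj_iff hxy, hη _ (Finset.mem_filter.2 ⟨Finset.mem_univ _, x,
        Sym2.mem_mk_left _ _, hx⟩)]
      simp only [f, decide_eq_true_eq]
      constructor
      · rintro ⟨x', y', h, hadj⟩
        rcases Sym2.eq_iff.1 h with ⟨rfl, rfl⟩ | ⟨rfl, rfl⟩
        · exact hadj
        · exact hsymm _ _ hadj
      · exact fun hadj => ⟨x, y, rfl, hadj⟩
  have hfac : ∀ e, Real.exp (-C * tileProb p hp R e) ≤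
      if f e then (tileProb p hp R e : ℝ) else 1 - tileProb p hp R e := by
    intro e
    by_cases hfe : f e = true
    · rw [if_pos hfe]
      obtain ⟨x, y, he, hadj⟩ := of_decide_eq_true hfe
      have hval : tileProb p hp R e = p ((x * s⁻¹) * (y * s⁻¹)⁻¹) := by
        rw [tileProb, he, Sym2.map_mk, edgeProb_mk]
        simp
      rw [hval]
      exact hC2 _ (Finset.mem_image.2 ⟨(_, _), Finset.mem_product.2
        ⟨hV _ _ hadj, hV _ _ (hsymm _ _ hadj)⟩, rfl⟩)
    · rw [if_neg hfe]
      obtain ⟨e, he⟩ := e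
      induction e using Sym2.ind with
      | _ x y => exact hC1 _
  have hpack : IsPacking R ({s⁻¹} : Set G) := fun x _ y _ a ha b hb _ => by
    rw [Set.mem_singleton_iff.1 ha, Set.mem_singleton_iff.1 hb]
  have hinj : Function.Injective (tileEdge R s⁻¹) := fun e e' h =>
    congrArg Prod.snd (tileEdge_injective hpack (a₁ := (⟨s⁻¹, rfl⟩, e)) (a₂ := (⟨s⁻¹, rfl⟩, e')) h)
  have hsum : ∑ e ∈ F, (tileProb p hp R e : ℝ) ≤ V.card * ∑' g, (p g : ℝ) := by
    have h := sum_edgeProb_le hp hs (X := V) (z := fun u => u) (W := fun _ => Set.univ)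
      (F.image (tileEdge R s⁻¹)) fun e he => by
        obtain ⟨e, heF, rfl⟩ := Finset.mem_image.1 he
        obtain ⟨x, hxe, hxV⟩ := (Finset.mem_filter.1 heF).2
        obtain ⟨y, hy⟩ := Sym2.mem_iff_exists.1 hxe
        refine ⟨x * s⁻¹, hxV, y * s⁻¹ * (x * s⁻¹)⁻¹, trivial, ?_⟩
        simp only [tileEdge, hy, Sym2.map_mk, inv_mul_cancel_right]
    rw [Finset.sum_image fun _ _ _ _ h => hinj h] at h
    simpa only [edgeProb_tileEdge, Set.indicator_univ, Finset.sum_const, nsmul_eq_mul] using h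
  calc Real.exp (-C * (V.card * ∑' g, (p g : ℝ)))
      ≤ Real.exp (-C * ∑ e ∈ F, (tileProb p hp R e : ℝ)) := by
        refine Real.exp_le_exp.2 ?_
        have := mul_le_mul_of_nonneg_left hsum hC0
        linarith
    _ = ∏ e ∈ F, Real.exp (-C * tileProb p hp R e) := by rw [Finset.mul_sum, Real.exp_sum]
    _ ≤ ∏ e ∈ F, if f e then (tileProb p hp R e : ℝ) else 1 - tileProb p hp R e :=
        Finset.prod_le_prod (fun _ _ => (Real.exp_pos _).le) fun e _ => hfac e
    _ = (bondMeasure (tileProb p hp R)).real {η | ∀ e ∈ F, η e = f e} := by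
        rw [measureReal_def, bondMeasure_cylinder, ENNReal.toReal_ofReal]
        exact Finset.prod_nonneg fun e _ => (Real.exp_pos _).le.trans (hfac e)
    _ ≤ _ := measureReal_mono hcyl

/-- An eigenvalue of a finite subgraph produces a jump of the finite-volume expectations, bounded
below uniformly in the volume. -/
theorem exists_le_approxIDS_sub (hp0 : ∀ x, 0 < (p x : ℝ)) (hp1 : ∀ x, (p x : ℝ) < 1)
    (hs : Summable fun x => (p x : ℝ)) {lam : ℝ} (hlam : lam ∈ finiteSubgraphSpectra G) :
    ∃ c, 0 < c ∧ ∃ K : Finset G, ∀ (R : Finset G), R.Nonempty → ∀ E < lam,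
      c * (1 - ∑ g ∈ K, exitRatio R g) ≤ approxIDS hp R lam - approxIDS hp R E := by
  classical
  obtain ⟨S, hS, hspec⟩ := hlam
  obtain ⟨v, hv0, hv⟩ := (mem_spectrum_lapMatrix_iff _ _).1 hspec
  obtain ⟨x₀, hx₀⟩ := Function.ne_iff.1 hv0
  set V : Finset G := S.verts.toFinset with hVdef
  let w : G → ℂ := fun x => if h : x ∈ S.verts then v ⟨x, h⟩ else 0
  have hwv : ∀ x : S.verts, w x = v x := fun x => dif_pos x.2
  have hw : ∀ u, u ∉ V → w u = 0 := fun u hu => dif_neg (by simpa [hVdef] using hu)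
  have hV : ∀ x y, S.Adj x y → x ∈ V := fun x y h => by simpa [hVdef] using S.edge_vert h
  have hsymm : ∀ x y, S.Adj x y → S.Adj y x := fun x y h => h.symm
  have heig : ∀ x ∈ V, ∑ y ∈ V, (if S.Adj x y then w x - w y else 0) = lam * w x := by
    intro x hx
    have hx' : x ∈ S.verts := by simpa [hVdef] using hx
    have h := hv ⟨x, hx'⟩
    rw [← hwv] at h
    rw [← h, ← Finset.sum_coe_sort V]
    refine Fintype.sum_equiv (Equiv.subtypeEquivRight fun y => by simp [hVdef]) _ _ fun y => ?_
    rw [← hwv]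
    rfl
  obtain ⟨c, hc0, hc⟩ := exists_le_measure_isIsolatedCopy hp hp0 hp1 hs hsymm hV
    fun x h => h.ne rfl
  have hw0 : 0 < ‖w x₀‖ ^ 2 := by
    have : 0 < ‖w x₀‖ := norm_pos_iff.2 (by rw [hwv]; exact hx₀)
    positivity
  have hx₀V : (x₀ : G) ∈ V := by simp [hVdef]
  have hwsum : 0 < ∑ u ∈ V, ‖w u‖ ^ 2 :=
    Finset.sum_pos' (fun _ _ => by positivity) ⟨x₀, hx₀V, hw0⟩
  -- The share of the eigenfunction's mass at the anchor `x₀`, the same for every translate.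
  set a : ℝ := ‖w x₀‖ ^ 2 / ∑ u ∈ V, ‖w u‖ ^ 2 with ha
  have ha0 : 0 < a := div_pos hw0 hwsum
  refine ⟨a * c, mul_pos ha0 hc0, V.image fun u => u * (x₀ : G)⁻¹, fun R hR E hE => ?_⟩
  set K : Finset G := V.image fun u => u * (x₀ : G)⁻¹ with hK
  have hr : (0 : ℝ) < R.card := by exact_mod_cast hR.card_pos
  -- The translate taking `x₀` to `x` must lie in `R`, which `IsIsolatedCopy` does not ensure; `K`
  -- collects the displacements from `x` to its points.
  let inner : Finset R := Finset.univ.filter fun x => ∀ u ∈ V, u * ((x₀ : G)⁻¹ * x) ∈ R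
  let X : Config R → Finset R := fun η =>
    inner.filter fun x => IsIsolatedCopy V S.Adj R ((x₀ : G)⁻¹ * x) η
  have hmult : ∀ η : Config R, a * (X η).card ≤
      (eigenvalueCount (patternLaplacian_isHermitian η) lam : ℝ) -
        eigenvalueCount (patternLaplacian_isHermitian η) E := by
    intro η
    refine (mul_card_le_multiplicity (patternLaplacian_isHermitian η) (lam := lam) (X η)
      fun x hx => ?_).trans (multiplicity_le_eigenvalueCount_sub _ hE)
    have hx1 : ∀ u ∈ V, u * ((x₀ : G)⁻¹ * x) ∈ R :=
      (Finset.mem_filter.1 (Finset.mem_filter.1 hx).1).2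
    have hx2 := (Finset.mem_filter.1 hx).2
    have hval : w ((x : G) * ((x₀ : G)⁻¹ * x)⁻¹) = w x₀ := by
      congr 1
      group
    refine ⟨fun y : R => w (y * ((x₀ : G)⁻¹ * x)⁻¹), fun h0 => ?_, ?_, ?_⟩
    · have h := congrFun h0 x
      simp only [hval, Pi.zero_apply] at h
      rw [h] at hw0
      simp at hw0
    · exact patternLaplacian_mulVec_translate hsymm hV hw heig hx1 hx2
    · rw [sum_translate_eq (F := fun u => ‖w u‖ ^ 2) hx1 fun u hu => by simp [hw u hu], ha,
        div_mul_cancel₀ _ hwsum.ne']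
      exact (congrArg (fun z => ‖z‖ ^ 2) hval).ge
  have hinner : (R.card : ℝ) * (1 - ∑ g ∈ K, exitRatio R g) ≤ inner.card := by
    have h1 := Finset.card_filter_add_card_filter_not (s := R) (fun x => ∃ g ∈ K, g * x ∉ R)
    have h2 := card_filter_exists_exit_le R K
    have h3 : (R.filter fun x => ¬ ∃ g ∈ K, g * x ∉ R).card ≤ inner.card := by
      rw [← Finset.card_map (Function.Embedding.subtype _) (s := inner)]
      refine Finset.card_le_card fun x hx => ?_
      obtain ⟨hxR, hx⟩ := Finset.mem_filter.1 hx
      push Not at hx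
      refine Finset.mem_map.2 ⟨⟨x, hxR⟩, Finset.mem_filter.2 ⟨Finset.mem_univ _, fun u hu => ?_⟩,
        rfl⟩
      rw [← mul_assoc]
      exact hx _ (Finset.mem_image_of_mem _ hu)
    have h1' : ((R.filter fun x => ∃ g ∈ K, g * x ∉ R).card : ℝ) +
        (R.filter fun x => ¬ ∃ g ∈ K, g * x ∉ R).card = R.card := by exact_mod_cast h1
    have h3' : ((R.filter fun x => ¬ ∃ g ∈ K, g * x ∉ R).card : ℝ) ≤ inner.card := by
      exact_mod_cast h3
    linarith
  -- Linearity of expectation over anchors; no independence is needed.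
  have hcount : c * inner.card ≤
      ∑ η : Config R, (bondMeasure (tileProb p hp R)).real {η} * (X η).card := by
    have h1 : ∀ η : Config R, ((X η).card : ℝ) =
        ∑ x ∈ inner, if IsIsolatedCopy V S.Adj R ((x₀ : G)⁻¹ * x) η then (1 : ℝ) else 0 :=
      fun η => by simp [X]
    simp only [h1, Finset.mul_sum]
    rw [Finset.sum_comm, mul_comm, ← nsmul_eq_mul]
    refine Finset.card_nsmul_le_sum _ _ _ fun x _ => (hc R ((x₀ : G)⁻¹ * x)).trans_eq ?_
    simp only [mul_ite, mul_one, mul_zero]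
    rw [← Finset.sum_filter, sum_measureReal_singleton]
    congr 1
    ext η
    simp
  unfold approxIDS
  rw [← sub_div, ← Finset.sum_sub_distrib, le_div_iff₀ hr]
  calc a * c * (1 - ∑ g ∈ K, exitRatio R g) * R.card
      = a * (c * (R.card * (1 - ∑ g ∈ K, exitRatio R g))) := by ring
    _ ≤ a * (c * inner.card) := by gcongr
    _ ≤ a * ∑ η : Config R, (bondMeasure (tileProb p hp R)).real {η} * (X η).card := by gcongr
    _ = ∑ η : Config R, (bondMeasure (tileProb p hp R)).real {η} * (a * (X η).card) := by
        rw [Finset.mul_sum]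
        exact Finset.sum_congr rfl fun η _ => by ring
    _ ≤ _ := Finset.sum_le_sum fun η _ => by
        rw [← mul_sub]
        exact mul_le_mul_of_nonneg_left (hmult η) measureReal_nonneg

end IsolatedCopies

end LongRangePercolation

end

/-! ### Conclusion: the discontinuities of the IDS. -/

open LongRangePercolation in
theorem corollary5 {G : Type*} [Group G]
    (P : Finset G) (hPsymm : ∀ x ∈ P, x⁻¹ ∈ P) (hPgen : Subgroup.closure (P : Set G) = ⊤)
    (Q : ℕ → Finset G) (hQfolner : IsFolnerSeq P Q) (hQtile : ∀ n, IsMonotile (Q n))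
    (hQtempered : IsTempered Q) (hQincr : IsStrictlyIncreasing Q)
    (p : G → unitInterval) (hpsymm : ∀ x, p x⁻¹ = p x)
    (hp0 : ∀ x, 0 < (p x : ℝ)) (hp1 : ∀ x, (p x : ℝ) < 1)
    (hpsum : Summable (fun x => (p x : ℝ))) :
    ∃ N : ℝ → ℝ, IsIDS p hpsymm Q N ∧
      {lam : ℝ | ¬ ContinuousAt N lam} = finiteSubgraphSpectra G ∧
      ∀ lam : ℝ, ¬ ContinuousAt N lam → ¬ Transcendental ℚ lam := by
  obtain ⟨N, hN, happrox⟩ := exists_isIDS hpsymm hp0 hpsum hPgen hQfolner hQincr hQtile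
  have hb : Tendsto (fun m => 6 * boundaryWeight p (Q m)) atTop (𝓝 0) := by
    simpa using (tendsto_boundaryWeight hPgen hQfolner hpsum).const_mul 6
  have hcont : ∀ lam, ¬ ContinuousAt N lam → lam ∈ finiteSubgraphSpectra G := fun lam h => by
    by_contra hlam
    refine h (continuousAt_of_locally_uniform_approx_of_continuousAt fun u hu => ?_)
    obtain ⟨ε, hε, hεu⟩ := Metric.mem_uniformity_dist.1 hu
    obtain ⟨m, hm⟩ := (hb.eventually (gt_mem_nhds hε)).exists
    exact ⟨Set.univ, Filter.univ_mem, approxIDS hpsymm (Q m),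
      continuousAt_approxIDS hpsymm (Q m) hlam,
      fun E _ => hεu ((happrox m E).trans_lt hm)⟩
  refine ⟨N, hN, Set.Subset.antisymm (fun lam h => hcont lam h) fun lam hlam hcts => ?_,
    fun lam h => not_not.2 (isAlgebraic_of_mem_finiteSubgraphSpectra (hcont lam h))⟩
  obtain ⟨c, hc, K, hK⟩ := exists_le_approxIDS_sub hpsymm hp0 hp1 hpsum hlam
  -- The limit over volumes is taken at fixed `E`; as `c` does not depend on `E`, left continuity at
  -- `lam` would force `c ≤ 0`.
  have hjump : ∀ E < lam, c ≤ N lam - N E := fun E hE => by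
    have h1 : Tendsto (fun m => c * (1 - ∑ g ∈ K, exitRatio (Q m) g)) atTop (𝓝 c) := by
      simpa using ((tendsto_finsetSum K fun g _ =>
        tendsto_exitRatio hPgen hQfolner g).const_sub 1).const_mul c
    have h2 : Tendsto (fun m => N lam - N E + 2 * (6 * boundaryWeight p (Q m))) atTop
        (𝓝 (N lam - N E)) := by
      simpa using (hb.const_mul 2).const_add (N lam - N E)
    refine le_of_tendsto_of_tendsto' h1 h2 fun m => (hK (Q m) (hQtile m).nonempty E hE).trans ?_
    have e1 := abs_le.1 (happrox m lam)
    have e2 := abs_le.1 (happrox m E)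
    linarith
  have hlim : Tendsto (fun E => N lam - N E) (𝓝[<] lam) (𝓝 (N lam - N lam)) :=
    (hcts.tendsto.mono_left nhdsWithin_le_nhds).const_sub _
  have := ge_of_tendsto hlim (eventually_mem_nhdsWithin.mono fun E hE => hjump E hE)
  linarith
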